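/- Let $0\le\sigma\le 1\le\Lambda<\infty$ and $S_{\sigma,\Lambda}=\{k\in\mathbb R^3:\ \sigma\le|k|<\Lambda\}$. Let $$\mathfrak h=\{f\in L^2(S_{\sigma,\Lambda};\mathbb C^3):\ k\cdot f(k)=0\ \text{for a.e. }k\}$$ be the one-photon Hilbert space, and let $|k|$ be the operator of multiplication by $|k|$ on $\mathfrak h$. For $\alpha>0$ and a real function $\phi\in L^2(\mathbb R^3)$ let $\Phi_{\phi,\alpha}:\mathfrak h\to L^2(\mathbb R^3;\mathbb C^3)$ be the bounded operator $$(\Phi_{\phi,\alpha}f)(x)=\alpha^{1/2}\,\phi(x)\,\check f(x),\qquad \check f(x)=(2\pi)^{-3/2}\int_{S_{\sigma,\Lambda}}e^{ik\cdot x}f(k)\,d^3k,$$ and put $\Theta_{\phi,\alpha}=\Phi_{\phi,\alpha}^*\Phi_{\phi,\alpha}$. (Up to the unitary Fourier transform, $\Phi_{\phi,\alpha}$ is the operator with momentum space kernel $\alpha^{1/2}(2\pi)^{-3/2}\hat\phi(p-k)(P_k^\perp)_{\mu\nu}\mathbf 1[\sigma\le|k|<\Lambda]$, where $\hat\phi(k)=(2\pi)^{-3/2}\int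 e^{-ik\cdot x}\phi(x)\,d^3x$ and $P_k^\perp$ is the orthogonal projection of $\mathbb C^3$ onto the complement of $k$.) For a bounded operator $A\ge0$ on $\mathfrak h$ let $$X(A)=\mathrm{Tr}\big(\sqrt{|k|^2+A}-|k|\big)\in[0,\infty].$$ For $L>0$ let $Y_L=H^1(B(0,L))$ denote the set of those $\phi\in H^1(\mathbb R^3)$ that vanish almost everywhere outside the ball $B(0,L)=\{x\in\mathbb R^3: |x|<L\}$. **Theorem.** There is a universal constant $C<\infty$ such that, for all $\alpha,L>0$, all $0\le\sigma\le1\le\Lambda<\infty$, all $0<\varepsilon\le1$ and all $\phi=|\phi|\in Y_L$, $$\tfrac12X(2\Theta_{\phi,\alpha})\ \le\ \sqrt{\frac{4\alpha}{9\pi}}\,\Big[(\Lambda^3-\sigma^3)+54\,\varepsilon\,\Lambda^3+5\,\sigma^{3/2}\Lambda^{3/2}\Big]\,\|\phi\|_1+\frac{C\,\alpha^{1/2}(L\Lambda+1)^3}{\varepsilon^2L^{3/2}\Lambda}\,\|\nabla\phi\|_2.$$ In particular, $\sqrt{|k|^2+2\Theta_{\phi,\alpha}}-|k|$ is trace class.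 -/

import Mathlib

open MeasureTheory Filter Topology
open scoped ENNReal NNReal ContDiff InnerProductSpace

/-! ### Trace of a nonnegative bounded operator -/

/-- The trace `∑ᵢ ⟪eᵢ, T eᵢ⟫ ∈ [0, ∞]` of a nonnegative bounded operator `T` on a Hilbert space,
computed in some Hilbert basis. For `T ≥ 0` the value does not depend on the basis
(`opTrace_eq_tsum`), and it is finite precisely if `T` is trace class. -/
noncomputable def opTrace {H : Type*} [NormedAddCommGroup H] [InnerProductSpace ℂ H]
    [CompleteSpace H] (T : H →L[ℂ] H) : ℝ≥0∞ :=
  ∑' e : (exists_hilbertBasis ℂ H).choose, ENNReal.ofReal (⟪(e : H), T e⟫_ℂ).re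

theorem tsum_ofReal_inner_sq {ι H : Type*} [NormedAddCommGroup H]
    [InnerProductSpace ℂ H] [CompleteSpace H] (b : HilbertBasis ι ℂ H) (x : H) :
    ∑' i, ENNReal.ofReal (‖⟪b i, x⟫_ℂ‖ ^ 2) = ENNReal.ofReal (‖x‖ ^ 2) := by
  have h1 := b.hasSum_inner_mul_inner x x
  have h2 : HasSum (fun i => ‖⟪b i, x⟫_ℂ‖ ^ 2) (‖x‖ ^ 2) := by
    have h3 := Complex.hasSum_re h1
    have h4 : (⟪x, x⟫_ℂ).re = ‖x‖ ^ 2 := by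
      rw [inner_self_eq_norm_sq_to_K]; norm_cast
    rw [h4] at h3
    refine h3.congr_fun ?_
    intro i
    rw [← inner_conj_symm x (b i), ← Complex.normSq_eq_conj_mul_self]
    rw [Complex.ofReal_re, Complex.normSq_eq_norm_sq]
  rw [← h2.tsum_eq, ENNReal.ofReal_tsum_of_nonneg (fun i => by positivity) h2.summable]

/-- Basis independence of the trace of a nonnegative operator. -/
theorem opTrace_eq_tsum {ι H : Type*} [NormedAddCommGroup H] [InnerProductSpace ℂ H]
    [CompleteSpace H] (T : H →L[ℂ] H) (hT : 0 ≤ T) (b : HilbertBasis ι ℂ H) :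
    opTrace T = ∑' i, ENNReal.ofReal (⟪b i, T (b i)⟫_ℂ).re := by
  have key : ∀ x, (⟪x, T x⟫_ℂ).re = ‖CFC.sqrt T x‖ ^ 2 := by
    intro x
    have hs : CFC.sqrt T * CFC.sqrt T = T := CFC.sqrt_mul_sqrt_self T hT
    have hsa : IsSelfAdjoint (CFC.sqrt T) := (CFC.sqrt_nonneg T).isSelfAdjoint
    have hsym := hsa.isSymmetric
    have h5 : T x = CFC.sqrt T (CFC.sqrt T x) := by
      conv_lhs => rw [← hs]
      rfl
    rw [h5]
    have h6 : ⟪x, CFC.sqrt T (CFC.sqrt T x)⟫_ℂ = ⟪CFC.sqrt T x, CFC.sqrt T x⟫_ℂ :=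
      (hsym x (CFC.sqrt T x)).symm
    rw [h6, inner_self_eq_norm_sq_to_K]
    norm_cast
  have hsym : ∀ x y, ‖⟪x, CFC.sqrt T y⟫_ℂ‖ = ‖⟪y, CFC.sqrt T x⟫_ℂ‖ := by
    intro x y
    have hsa : IsSelfAdjoint (CFC.sqrt T) := (CFC.sqrt_nonneg T).isSelfAdjoint
    have h6 : ⟪CFC.sqrt T x, y⟫_ℂ = ⟪x, CFC.sqrt T y⟫_ℂ := hsa.isSymmetric x y
    rw [← h6, ← inner_conj_symm, RCLike.norm_conj]
  obtain ⟨c, hc⟩ := (exists_hilbertBasis ℂ H).choose_spec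
  unfold opTrace
  have hc' : ∀ e : (exists_hilbertBasis ℂ H).choose, (e : H) = c e := fun e => by rw [hc]
  calc _ = ∑' e : (exists_hilbertBasis ℂ H).choose,
        ∑' i, ENNReal.ofReal (‖⟪b i, CFC.sqrt T (c e)⟫_ℂ‖ ^ 2) := by
        refine tsum_congr fun e => ?_
        rw [tsum_ofReal_inner_sq b, key, hc']
    _ = ∑' i, ∑' e : (exists_hilbertBasis ℂ H).choose,
        ENNReal.ofReal (‖⟪b i, CFC.sqrt T (c e)⟫_ℂ‖ ^ 2) := ENNReal.tsum_comm
    _ = _ := by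
        refine tsum_congr fun i => ?_
        rw [key, ← tsum_ofReal_inner_sq c]
        exact tsum_congr fun e => by rw [hsym]

namespace LiebLoss

/-! ### The one-photon Hilbert space -/

/-- Position (or momentum) space `ℝ³`. -/
abbrev E3 : Type := EuclideanSpace ℝ (Fin 3)

/-- Values of vector fields, `ℂ ⊗ ℝ³`. -/
abbrev V3 : Type := EuclideanSpace ℂ (Fin 3)

/-- The momentum shell `{k : σ ≤ |k| < Λ}`. -/
def shell (σ Λ : ℝ) : Set E3 := {k | σ ≤ ‖k‖ ∧ ‖k‖ < Λ}

/-- Lebesgue measure on the momentum shell. -/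
noncomputable abbrev shellMeasure (σ Λ : ℝ) : Measure E3 := volume.restrict (shell σ Λ)

theorem measurableSet_shell (σ Λ : ℝ) : MeasurableSet (shell σ Λ) :=
  (measurableSet_le measurable_const measurable_norm).inter
    (measurableSet_lt measurable_norm measurable_const)

instance (σ Λ : ℝ) : IsFiniteMeasure (shellMeasure σ Λ) :=
  isFiniteMeasure_restrict.2 (ne_of_lt (lt_of_le_of_lt
    (measure_mono (t := Metric.ball 0 Λ) fun _ hk => mem_ball_zero_iff.2 hk.2)
    measure_ball_lt_top))

theorem ae_norm_le (σ Λ : ℝ) : ∀ᵐ k ∂shellMeasure σ Λ, ‖k‖ ≤ Λ := by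
  filter_upwards [ae_restrict_mem (measurableSet_shell σ Λ)] with k hk using hk.2.le

/-- The one-photon space: square-integrable vector fields on the momentum shell
which are divergence-free, i.e. `k ⊥ f(k)` for almost every `k`. -/
noncomputable def photonSubmodule (σ Λ : ℝ) : Submodule ℂ (Lp V3 2 (shellMeasure σ Λ)) where
  carrier := {f | ∀ᵐ k ∂shellMeasure σ Λ, ∑ i, (k i : ℂ) * f k i = 0}
  add_mem' := by
    intro f g hf hg
    simp only [Set.mem_ofPred_eq] at *
    filter_upwards [hf, hg, Lp.coeFn_add f g] with k h1 h2 h3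
    rw [h3]
    simp [mul_add, Finset.sum_add_distrib, h1, h2]
  zero_mem' := by
    simp only [Set.mem_ofPred_eq]
    filter_upwards [Lp.coeFn_zero V3 2 (shellMeasure σ Λ)] with k h
    rw [h]; simp
  smul_mem' := by
    intro c f hf
    simp only [Set.mem_ofPred_eq] at *
    filter_upwards [hf, Lp.coeFn_smul c f] with k h1 h2
    rw [h2]
    have : ∀ i, (k i : ℂ) * (c • (f : E3 → V3)) k i = c * ((k i : ℂ) * f k i) := fun i => by
      simp; ring
    simp only [this, ← Finset.mul_sum, h1, mul_zero]

theorem isClosed_photonSubmodule (σ Λ : ℝ) :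
    IsClosed (photonSubmodule σ Λ : Set (Lp V3 2 (shellMeasure σ Λ))) := by
  refine IsSeqClosed.isClosed fun u f hu hf => ?_
  obtain ⟨n, -, hn⟩ := (tendstoInMeasure_of_tendsto_Lp hf).exists_seq_tendsto_ae
  have hall : ∀ᵐ k ∂shellMeasure σ Λ, ∀ m, ∑ i, (k i : ℂ) * u m k i = 0 :=
    ae_all_iff.2 hu
  change ∀ᵐ k ∂shellMeasure σ Λ, ∑ i, (k i : ℂ) * f k i = 0
  filter_upwards [hn, hall] with k hk hz
  have hc : Continuous fun v : V3 => ∑ i, (k i : ℂ) * v i := by fun_prop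
  have := (hc.tendsto _).comp hk
  refine tendsto_nhds_unique this ?_
  simp only [Function.comp_def, hz]
  exact tendsto_const_nhds

/-- The one-photon Hilbert space. -/
abbrev Photon (σ Λ : ℝ) : Type := photonSubmodule σ Λ

instance (σ Λ : ℝ) : CompleteSpace (Photon σ Λ) :=
  (isClosed_photonSubmodule σ Λ).completeSpace_coe

/-! ### The multiplication operator `|k|` -/

theorem memLp_normMul (σ Λ : ℝ) (f : Lp V3 2 (shellMeasure σ Λ)) :
    MemLp (fun k => ((‖k‖ : ℝ) : ℂ) • f k) 2 (shellMeasure σ Λ) := by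
  refine MemLp.of_le_mul (c := Λ) (Lp.memLp f) ?_ ?_
  · exact (by fun_prop : Continuous fun k : E3 => ((‖k‖ : ℝ) : ℂ)).aestronglyMeasurable.smul
      (Lp.aestronglyMeasurable f)
  · filter_upwards [ae_norm_le σ Λ] with k hk
    rw [norm_smul]
    simp only [Complex.norm_real, norm_norm]
    gcongr

/-- The operator `|k|` on the one-photon space, `(|k| f)(k) = |k| f(k)`. -/
noncomputable def absK (σ Λ : ℝ) : Photon σ Λ →L[ℂ] Photon σ Λ :=
  LinearMap.mkContinuous
    { toFun := fun f => ⟨(memLp_normMul σ Λ f.1).toLp _, by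
        change ∀ᵐ k ∂shellMeasure σ Λ, _
        filter_upwards [(memLp_normMul σ Λ f.1).coeFn_toLp, f.2] with k h1 h2
        rw [h1]
        have : ∀ i, (k i : ℂ) * ((((‖k‖ : ℝ) : ℂ) • f.1 k : V3) i)
            = ((‖k‖ : ℝ) : ℂ) * ((k i : ℂ) * f.1 k i) := fun i => by
          simp; ring
        simp only [this, ← Finset.mul_sum, h2, mul_zero]⟩
      map_add' := fun f g => by
        refine Subtype.ext (Lp.ext ?_)
        change _ =ᵐ[_] ((_ + _ : Lp V3 2 (shellMeasure σ Λ)) : E3 → V3)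
        filter_upwards [(memLp_normMul σ Λ (f + g).1).coeFn_toLp,
          (memLp_normMul σ Λ f.1).coeFn_toLp, (memLp_normMul σ Λ g.1).coeFn_toLp,
          Lp.coeFn_add f.1 g.1,
          Lp.coeFn_add ((memLp_normMul σ Λ f.1).toLp _) ((memLp_normMul σ Λ g.1).toLp _)]
          with k h1 h2 h3 h4 h5
        rw [h5, Pi.add_apply, h1, h2, h3, ← smul_add]
        congr 1
      map_smul' := fun c f => by
        refine Subtype.ext (Lp.ext ?_)
        change _ =ᵐ[_] ((c • _ : Lp V3 2 (shellMeasure σ Λ)) : E3 → V3)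
        filter_upwards [(memLp_normMul σ Λ (c • f).1).coeFn_toLp,
          (memLp_normMul σ Λ f.1).coeFn_toLp, Lp.coeFn_smul c f.1,
          Lp.coeFn_smul c ((memLp_normMul σ Λ f.1).toLp _)] with k h1 h2 h3 h4
        rw [h4, Pi.smul_apply, h1, h2, smul_comm c]
        congr 1 }
    Λ (fun f => by
      change ‖(memLp_normMul σ Λ f.1).toLp _‖ ≤ Λ * ‖f.1‖
      refine Lp.norm_le_mul_norm_of_ae_le_mul ?_
      filter_upwards [(memLp_normMul σ Λ f.1).coeFn_toLp, ae_norm_le σ Λ] with k h1 h2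
      rw [h1, norm_smul]
      simp only [Complex.norm_real, norm_norm]
      gcongr)

theorem absK_apply (σ Λ : ℝ) (f : Photon σ Λ) :
    (absK σ Λ f).1 =ᵐ[shellMeasure σ Λ] fun k => ((‖k‖ : ℝ) : ℂ) • f.1 k :=
  (memLp_normMul σ Λ f.1).coeFn_toLp

theorem absK_nonneg (σ Λ : ℝ) : 0 ≤ absK σ Λ := by
  rw [ContinuousLinearMap.nonneg_iff_isPositive, ContinuousLinearMap.isPositive_iff_complex]
  intro f
  have h : ⟪absK σ Λ f, f⟫_ℂ = ((∫ k, ‖k‖ * ‖f.1 k‖ ^ 2 ∂shellMeasure σ Λ : ℝ) : ℂ) := by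
    change ⟪(absK σ Λ f).1, f.1⟫_ℂ = _
    rw [L2.inner_def, ← integral_complex_ofReal]
    refine integral_congr_ae ?_
    filter_upwards [absK_apply σ Λ f] with k hk
    rw [hk, inner_smul_left, inner_self_eq_norm_sq_to_K]
    simp
  rw [h]
  refine ⟨by simp, ?_⟩
  simp only [RCLike.re_eq_complex_re, Complex.ofReal_re]
  exact integral_nonneg fun k => by positivity

/-! ### The operators `Φ` and `Θ` -/

/-- The unitarily normalised inverse Fourier transform
`(2π)^{-3/2} ∫ e^{i k·x} f(k) dk` of a vector field supported in the momentum shell. -/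
noncomputable def invFourier (σ Λ : ℝ) (f : Photon σ Λ) (x : E3) : V3 :=
  (((2 * Real.pi) ^ (-(3 / 2) : ℝ) : ℝ) : ℂ) •
    ∫ k, Complex.exp (Complex.I * ((⟪k, x⟫_ℝ : ℝ) : ℂ)) • f.1 k ∂shellMeasure σ Λ

theorem norm_cexp (k x : E3) : ‖Complex.exp (Complex.I * ((⟪k, x⟫_ℝ : ℝ) : ℂ))‖ = 1 := by
  rw [mul_comm]; exact Complex.norm_exp_ofReal_mul_I _

theorem integrable_photon (σ Λ : ℝ) (f : Photon σ Λ) :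
    Integrable (fun k => f.1 k) (shellMeasure σ Λ) :=
  (Lp.memLp f.1).integrable one_le_two

theorem aesm_integrand (σ Λ : ℝ) (f : Photon σ Λ) (x : E3) :
    AEStronglyMeasurable
      (fun k : E3 => Complex.exp (Complex.I * ((⟪k, x⟫_ℝ : ℝ) : ℂ)) • f.1 k)
      (shellMeasure σ Λ) := by
  have hc : Continuous fun k : E3 => Complex.exp (Complex.I * ((⟪k, x⟫_ℝ : ℝ) : ℂ)) := by
    fun_prop
  exact hc.aestronglyMeasurable.smul (Lp.aestronglyMeasurable f.1)

theorem integrable_integrand (σ Λ : ℝ) (f : Photon σ Λ) (x : E3) :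
    Integrable (fun k : E3 => Complex.exp (Complex.I * ((⟪k, x⟫_ℝ : ℝ) : ℂ)) • f.1 k)
      (shellMeasure σ Λ) :=
  (integrable_photon σ Λ f).mono (aesm_integrand σ Λ f x) (Eventually.of_forall fun k => by
    rw [norm_smul, norm_cexp, one_mul])

theorem continuous_invFourier (σ Λ : ℝ) (f : Photon σ Λ) : Continuous (invFourier σ Λ f) := by
  have h : Continuous fun x : E3 =>
      ∫ k, Complex.exp (Complex.I * ((⟪k, x⟫_ℝ : ℝ) : ℂ)) • f.1 k ∂shellMeasure σ Λ := by
    refine continuous_of_dominated (bound := fun k => ‖f.1 k‖) (aesm_integrand σ Λ f) ?_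
      (integrable_photon σ Λ f).norm ?_
    · exact fun x => Eventually.of_forall fun k => by rw [norm_smul, norm_cexp, one_mul]
    · exact Eventually.of_forall fun k => by fun_prop
  exact h.const_smul (((2 * Real.pi) ^ (-(3 / 2) : ℝ) : ℝ) : ℂ)

theorem invFourier_add (σ Λ : ℝ) (f g : Photon σ Λ) (x : E3) :
    invFourier σ Λ (f + g) x = invFourier σ Λ f x + invFourier σ Λ g x := by
  unfold invFourier
  rw [← smul_add, ← integral_add (integrable_integrand σ Λ f x) (integrable_integrand σ Λ g x)]
  congr 1
  refine integral_congr_ae ?_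
  filter_upwards [Lp.coeFn_add f.1 g.1] with k hk
  rw [← smul_add]
  congr 1

theorem invFourier_smul (σ Λ : ℝ) (c : ℂ) (f : Photon σ Λ) (x : E3) :
    invFourier σ Λ (c • f) x = c • invFourier σ Λ f x := by
  unfold invFourier
  have h : ∫ k, Complex.exp (Complex.I * ((⟪k, x⟫_ℝ : ℝ) : ℂ)) • (c • f).1 k ∂shellMeasure σ Λ
      = c • ∫ k, Complex.exp (Complex.I * ((⟪k, x⟫_ℝ : ℝ) : ℂ)) • f.1 k ∂shellMeasure σ Λ := by
    rw [← integral_smul]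
    refine integral_congr_ae ?_
    filter_upwards [Lp.coeFn_smul c f.1] with k hk
    rw [smul_comm c]
    congr 1
  rw [h, smul_comm c]

/-- A constant bounding `‖invFourier f‖_∞` by the `L²`-norm of `f`. -/
noncomputable def invFourierBound (σ Λ : ℝ) : ℝ :=
  (2 * Real.pi) ^ (-(3 / 2) : ℝ) * ((shellMeasure σ Λ).real Set.univ) ^ (1 / 2 : ℝ)

theorem norm_invFourier_le (σ Λ : ℝ) (f : Photon σ Λ) (x : E3) :
    ‖invFourier σ Λ f x‖ ≤ invFourierBound σ Λ * ‖f‖ := by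
  unfold invFourier invFourierBound
  rw [norm_smul, Complex.norm_real, Real.norm_of_nonneg (by positivity), mul_assoc]
  refine mul_le_mul_of_nonneg_left ?_ (by positivity)
  have h0 : ‖∫ k, Complex.exp (Complex.I * ((⟪k, x⟫_ℝ : ℝ) : ℂ)) • f.1 k ∂shellMeasure σ Λ‖
      ≤ ∫ k, ‖f.1 k‖ ∂shellMeasure σ Λ := by
    refine norm_integral_le_of_norm_le (integrable_photon σ Λ f).norm ?_
    exact Eventually.of_forall fun k => by rw [norm_smul, norm_cexp, one_mul]
  refine h0.trans ?_
  have h1 : ∫ k, ‖f.1 k‖ ∂shellMeasure σ Λ = (eLpNorm (f.1) 1 (shellMeasure σ Λ)).toReal := by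
    rw [eLpNorm_one_eq_lintegral_enorm, integral_norm_eq_lintegral_enorm
      (Lp.aestronglyMeasurable f.1)]
  rw [h1]
  have h2 := eLpNorm_le_eLpNorm_mul_rpow_measure_univ (p := 1) (q := 2) one_le_two
    (Lp.aestronglyMeasurable f.1)
  have h3 : ‖f‖ = (eLpNorm (f.1) 2 (shellMeasure σ Λ)).toReal := Lp.norm_def f.1
  rw [h3, mul_comm]
  have h4 : (shellMeasure σ Λ).real Set.univ ^ (1 / 2 : ℝ)
      = ((shellMeasure σ Λ) Set.univ ^ (1 / 2 : ℝ)).toReal := by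
    rw [Measure.real, ENNReal.toReal_rpow]
  rw [h4, ← ENNReal.toReal_mul]
  refine ENNReal.toReal_mono (ENNReal.mul_ne_top (Lp.eLpNorm_ne_top f.1)
    (ENNReal.rpow_ne_top_of_nonneg (by norm_num) (measure_ne_top _ _))) ?_
  convert h2 using 3
  norm_num

theorem memLp_phi (α σ Λ : ℝ) (φ : Lp ℝ 2 (volume : Measure E3)) (f : Photon σ Λ) :
    MemLp (fun x => ((√α * φ x : ℝ) : ℂ) • invFourier σ Λ f x) 2 volume := by
  refine MemLp.of_le_mul (c := |√α| * (invFourierBound σ Λ * ‖f‖)) (Lp.memLp φ) ?_ ?_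
  · have h : AEStronglyMeasurable (fun x => ((√α * φ x : ℝ) : ℂ)) (volume : Measure E3) :=
      Complex.continuous_ofReal.comp_aestronglyMeasurable
        ((Lp.aestronglyMeasurable φ).const_mul _)
    exact h.smul (continuous_invFourier σ Λ f).aestronglyMeasurable
  · refine Eventually.of_forall fun x => ?_
    rw [norm_smul, Complex.norm_real, norm_mul, Real.norm_eq_abs (√α)]
    have := norm_invFourier_le σ Λ f x
    calc _ ≤ |√α| * ‖φ x‖ * (invFourierBound σ Λ * ‖f‖) := by gcongr
      _ = _ := by ring

/-- The operator `Φ_{φ,α} f = α^{1/2} φ(x) · (inverse Fourier transform of f)`, from the one-photon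
space to `L²(ℝ³; ℂ ⊗ ℝ³)` in position space. In momentum space, i.e. after applying the unitary
Fourier transform, it has the kernel `α^{1/2} (2π)^{-3/2} φ̂(p - k) (P_k^⊥)_{μν} 1[σ ≤ |k| < Λ]`. -/
noncomputable def Phi (α σ Λ : ℝ) (φ : Lp ℝ 2 (volume : Measure E3)) :
    Photon σ Λ →L[ℂ] Lp V3 2 (volume : Measure E3) :=
  LinearMap.mkContinuous
    { toFun := fun f => (memLp_phi α σ Λ φ f).toLp _
      map_add' := fun f g => by
        rw [← MemLp.toLp_add]
        exact MemLp.toLp_congr _ _ (Eventually.of_forall fun x => by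
          simp only [Pi.add_apply, invFourier_add, smul_add])
      map_smul' := fun c f => by
        rw [RingHom.id_apply, ← MemLp.toLp_const_smul]
        exact MemLp.toLp_congr _ _ (Eventually.of_forall fun x => by
          simp only [Pi.smul_apply, invFourier_smul]
          rw [smul_comm]) }
    (|√α| * invFourierBound σ Λ * ‖φ‖) (fun f => by
      change ‖(memLp_phi α σ Λ φ f).toLp _‖ ≤ _
      have h : ‖(memLp_phi α σ Λ φ f).toLp _‖
          ≤ (|√α| * (invFourierBound σ Λ * ‖f‖)) * ‖φ‖ := by
        refine Lp.norm_le_mul_norm_of_ae_le_mul ?_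
        filter_upwards [(memLp_phi α σ Λ φ f).coeFn_toLp] with x hx
        rw [hx, norm_smul, Complex.norm_real, norm_mul, Real.norm_eq_abs (√α)]
        have := norm_invFourier_le σ Λ f x
        calc _ ≤ |√α| * ‖φ x‖ * (invFourierBound σ Λ * ‖f‖) := by gcongr
          _ = _ := by ring
      refine h.trans (le_of_eq ?_)
      ring)

/-- `Θ_{φ,α} = Φ_{φ,α}^* Φ_{φ,α}`, a bounded nonnegative operator on the one-photon space. -/
noncomputable def Theta (α σ Λ : ℝ) (φ : Lp ℝ 2 (volume : Measure E3)) :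
    Photon σ Λ →L[ℂ] Photon σ Λ :=
  (ContinuousLinearMap.adjoint (Phi α σ Λ φ)).comp (Phi α σ Λ φ)

theorem Theta_nonneg (α σ Λ : ℝ) (φ : Lp ℝ 2 (volume : Measure E3)) : 0 ≤ Theta α σ Λ φ := by
  rw [ContinuousLinearMap.nonneg_iff_isPositive]
  exact ContinuousLinearMap.isPositive_adjoint_comp_self _

/-! ### The functional `X` -/

/-- The operator `√(K² + A) - K`, with the square root of the functional calculus. -/
noncomputable def sqrtDiff {H : Type*} [NormedAddCommGroup H] [InnerProductSpace ℂ H]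
    [CompleteSpace H] (K A : H →L[ℂ] H) : H →L[ℂ] H :=
  CFC.sqrt (K * K + A) - K

theorem sqrtDiff_nonneg {H : Type*} [NormedAddCommGroup H] [InnerProductSpace ℂ H]
    [CompleteSpace H] {K A : H →L[ℂ] H} (hK : 0 ≤ K) (hA : 0 ≤ A) : 0 ≤ sqrtDiff K A := by
  unfold sqrtDiff
  rw [sub_nonneg]
  calc K = CFC.sqrt (K * K) := (CFC.sqrt_mul_self K hK).symm
    _ ≤ CFC.sqrt (K * K + A) := CFC.sqrt_le_sqrt _ _ (le_add_of_nonneg_right hA)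

/-- `X(A) = Tr(√(|k|² + A) - |k|)` for nonnegative bounded operators `A` on the one-photon space.
The operator under the trace is nonnegative by `sqrtDiff_nonneg`. -/
noncomputable def X (σ Λ : ℝ) (A : Photon σ Λ →L[ℂ] Photon σ Λ) : ℝ≥0∞ :=
  opTrace (sqrtDiff (absK σ Λ) A)

/-! ### Sobolev functions supported in a ball -/

/-- `g` is the weak gradient of `φ` on `ℝ³`:
`∫ φ ∂_v ψ = - ∫ ⟨g, v⟩ ψ` for all test functions `ψ ∈ C_c^∞(ℝ³)` and all directions `v`. -/
def IsWeakGradient (φ : Lp ℝ 2 (volume : Measure E3)) (g : Lp E3 2 (volume : Measure E3)) : Prop :=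
  ∀ ψ : E3 → ℝ, ContDiff ℝ ∞ ψ → HasCompactSupport ψ → ∀ v : E3,
    ∫ x, φ x * fderiv ℝ ψ x v = - ∫ x, ⟪g x, v⟫_ℝ * ψ x

/-- `φ ∈ H¹(B(0,L))`, with weak gradient `g`: a function in `H¹(ℝ³)` that vanishes
outside the ball `B(0,L)`. -/
structure MemY (L : ℝ) (φ : Lp ℝ 2 (volume : Measure E3))
    (g : Lp E3 2 (volume : Measure E3)) : Prop where
  weakGradient : IsWeakGradient φ g
  support : ∀ᵐ x : E3, x ∉ Metric.ball (0 : E3) L → φ x = 0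

end LiebLoss

open LiebLoss

/-! Put `K = |k|` and `Ψ = √2 Φ`, so that `2Θ = Ψ⋆Ψ`. The operator-theoretic half of the proof is
the inequality `Tr(√(K² + Ψ⋆Ψ) - K) ≤ ‖Ψ‖₁`. In finite dimensions let `R = √(K² + Ψ⋆Ψ)` have
eigenvectors `eᵢ` and eigenvalues `rᵢ`. Where `rᵢ ≠ 0`, `rᵢ = rᵢ⁻¹‖K eᵢ‖² + rᵢ⁻¹‖Ψ eᵢ‖²`. Since `‖K
x‖` and `‖Ψ x‖` are at most `‖R x‖`, the vectors `rᵢ⁻¹ K eᵢ` and `rᵢ⁻¹ Ψ eᵢ` form Bessel families,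
so the two sums are bounded by the trace norms of `K` and `Ψ`: `Tr R ≤ Tr K + ‖Ψ‖₁`
(`sum_inner_le_of_mul_self_eq`). Compression to finite-dimensional subspaces and strong continuity
of the square root give the general case (`opTrace_sqrtDiff_le`). Hence `½ X(2Θ) ≤ ‖Φ‖₁ / √2`.

It remains to bound `‖Φ‖₁`. Cut space into cubes of side `2/Λ` and expand `e^{ik·x}` around the
centre `c` of the cube containing `x`. Since `|k||x - c| ≤ √3`, the series converges uniformly. Its
terms are finite rank, and the trace norm of each is at most a product of an `L²` norm in `k` and
one in `x` (`traceNormLE_cellOperator`). On every cube split `φ` into its mean and its deviation.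
The means add up to a multiple of `‖φ‖₁`. The deviations are controlled by `∇φ` through a Poincaré
estimate derived from translations (`sum_cellOscillation_sq_le`), and Cauchy-Schwarz over the at
most `8(LΛ+1)³` cubes covering the ball turns this into the gradient term.

The coefficient of `‖φ‖₁` obtained in this way is at most `√(4α/(9π)) Λ³`, because `momentSum² ≤
128π/27`. The bracket in the theorem is at least `Λ³`, as `σ³ ≤ σ^{3/2} Λ^{3/2}`. The estimate thus
holds without `ε`, and inserting `ε` only weakens it. -/

/-! ### Trace norm bounds by duality -/

section TraceNorm

variable {H W : Type*} [NormedAddCommGroup H] [InnerProductSpace ℂ H]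
  [NormedAddCommGroup W] [InnerProductSpace ℂ W]

/-- A finite family of vectors satisfying Bessel's inequality. -/
def IsBessel {n : ℕ} (e : Fin n → H) : Prop :=
  ∀ x, ∑ i, ‖⟪e i, x⟫_ℂ‖ ^ 2 ≤ ‖x‖ ^ 2

theorem Orthonormal.isBessel {n : ℕ} {e : Fin n → H} (he : Orthonormal ℂ e) : IsBessel e :=
  fun x => he.sum_inner_products_le (s := Finset.univ) x

/-- The map `c ↦ ∑ cᵢ eᵢ` and its adjoint `x ↦ (⟪eᵢ, x⟫)ᵢ` have the same norm. Concretely, take `cᵢ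
= ⟪eᵢ, x⟫` and apply Cauchy-Schwarz. -/
theorem IsBessel.of_norm_sum_le {n : ℕ} {e : Fin n → H}
    (he : ∀ c : Fin n → ℂ, ‖∑ i, c i • e i‖ ^ 2 ≤ ∑ i, ‖c i‖ ^ 2) : IsBessel e := by
  intro x
  set A := ∑ i, ‖⟪e i, x⟫_ℂ‖ ^ 2 with hA
  have hA0 : 0 ≤ A := by positivity
  have h1 : (A : ℂ) = ⟪∑ i, ⟪e i, x⟫_ℂ • e i, x⟫_ℂ := by
    rw [sum_inner, hA]
    push_cast
    refine Finset.sum_congr rfl fun i _ => ?_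
    rw [inner_smul_left, ← Complex.normSq_eq_conj_mul_self, Complex.normSq_eq_norm_sq]
    norm_cast
  have h2 : A ≤ ‖∑ i, ⟪e i, x⟫_ℂ • e i‖ * ‖x‖ := by
    have := norm_inner_le_norm (𝕜 := ℂ) (∑ i, ⟪e i, x⟫_ℂ • e i) x
    rw [← h1] at this
    simpa [abs_of_nonneg hA0] using this
  have h3 := he fun i => ⟪e i, x⟫_ℂ
  rw [← hA] at h3
  have h4 : A ^ 2 ≤ A * ‖x‖ ^ 2 := by
    calc A ^ 2 ≤ (‖∑ i, ⟪e i, x⟫_ℂ • e i‖ * ‖x‖) ^ 2 := by gcongr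
      _ = ‖∑ i, ⟪e i, x⟫_ℂ • e i‖ ^ 2 * ‖x‖ ^ 2 := by ring
      _ ≤ A * ‖x‖ ^ 2 := by gcongr
  rcases hA0.eq_or_lt with h | h
  · rw [← h]; positivity
  · nlinarith

/-- The trace norm of `T` is at most `S`. -/
def TraceNormLE (T : H →L[ℂ] W) (S : ℝ) : Prop :=
  ∀ (n : ℕ) (e : Fin n → H) (w : Fin n → W), IsBessel e → IsBessel w →
    ‖∑ i, ⟪w i, T (e i)⟫_ℂ‖ ≤ S

theorem TraceNormLE.mono {T : H →L[ℂ] W} {S S' : ℝ} (h : TraceNormLE T S) (hS : S ≤ S') :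
    TraceNormLE T S' := fun n e w he hw => (h n e w he hw).trans hS

theorem TraceNormLE.zero : TraceNormLE (0 : H →L[ℂ] W) 0 := fun n e w _ _ => by simp

theorem TraceNormLE.add {T T' : H →L[ℂ] W} {S S' : ℝ} (h : TraceNormLE T S)
    (h' : TraceNormLE T' S') : TraceNormLE (T + T') (S + S') := fun n e w he hw => by
  simp only [add_apply, inner_add_right, Finset.sum_add_distrib]
  exact (norm_add_le _ _).trans (add_le_add (h n e w he hw) (h' n e w he hw))

theorem TraceNormLE.smul {T : H →L[ℂ] W} {S : ℝ} (h : TraceNormLE T S) (c : ℂ) :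
    TraceNormLE (c • T) (‖c‖ * S) := fun n e w he hw => by
  simp only [smul_apply, inner_smul_right, ← Finset.mul_sum, norm_mul]
  gcongr
  exact h n e w he hw

theorem TraceNormLE.sum {ι : Type*} (s : Finset ι) {T : ι → H →L[ℂ] W} {S : ι → ℝ}
    (h : ∀ i ∈ s, TraceNormLE (T i) (S i)) : TraceNormLE (∑ i ∈ s, T i) (∑ i ∈ s, S i) := by
  classical
  induction s using Finset.induction_on with
  | empty => simpa using TraceNormLE.zero
  | insert a s ha ih =>
    rw [Finset.sum_insert ha, Finset.sum_insert ha]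
    exact (h a (Finset.mem_insert_self _ _)).add
      (ih fun i hi => h i (Finset.mem_insert_of_mem hi))

/-- Each test involves only finitely many vectors, so the trace norm is lower semicontinuous under
mere strong convergence. -/
theorem TraceNormLE.of_tendsto {T : H →L[ℂ] W} {Tn : ℕ → H →L[ℂ] W} {S : ℝ}
    (h : ∀ m, TraceNormLE (Tn m) S) (hT : ∀ x, Tendsto (fun m => Tn m x) atTop (𝓝 (T x))) :
    TraceNormLE T S := fun n e w he hw => by
  have h1 : Tendsto (fun m => ‖∑ i, ⟪w i, Tn m (e i)⟫_ℂ‖) atTop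
      (𝓝 ‖∑ i, ⟪w i, T (e i)⟫_ℂ‖) :=
    (tendsto_finsetSum _ fun i _ => tendsto_const_nhds.inner (hT (e i))).norm
  exact le_of_tendsto' h1 fun m => h m n e w he hw

theorem IsBessel.sum_clm_sq_le [CompleteSpace H] {n : ℕ} {e : Fin n → H} (he : IsBessel e)
    (l : H →L[ℂ] ℂ) : ∑ i, ‖l (e i)‖ ^ 2 ≤ ‖l‖ ^ 2 := by
  have h := he ((InnerProductSpace.toDual ℂ H).symm l)
  rw [LinearIsometryEquiv.norm_map] at h
  refine le_trans (le_of_eq (Finset.sum_congr rfl fun i _ => ?_)) h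
  rw [← inner_conj_symm, RCLike.norm_conj, InnerProductSpace.toDual_symm_apply]

/-- For a rank one operator the pairing factorises, and Cauchy-Schwarz plus Bessel on each side
suffices. All trace norm bounds below are built from this case. -/
theorem TraceNormLE.smulRight [CompleteSpace H] (l : H →L[ℂ] ℂ) (u : W) :
    TraceNormLE (l.smulRight u) (‖l‖ * ‖u‖) := fun n e w he hw => by
  simp only [ContinuousLinearMap.smulRight_apply, inner_smul_right]
  calc ‖∑ i, l (e i) * ⟪w i, u⟫_ℂ‖ ≤ ∑ i, ‖l (e i)‖ * ‖⟪w i, u⟫_ℂ‖ := by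
        refine (norm_sum_le _ _).trans (le_of_eq ?_)
        simp
    _ ≤ √(∑ i, ‖l (e i)‖ ^ 2) * √(∑ i, ‖⟪w i, u⟫_ℂ‖ ^ 2) := Real.sum_mul_le_sqrt_mul_sqrt _ _ _
    _ ≤ √(‖l‖ ^ 2) * √(‖u‖ ^ 2) := by
        gcongr
        · exact he.sum_clm_sq_le l
        · exact hw u
    _ = _ := by rw [Real.sqrt_sq (norm_nonneg _), Real.sqrt_sq (norm_nonneg _)]

/-- A Bessel family in `U` is one in `H`, since its inner products with `x` only see the projection
of `x` to `U`. -/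
theorem TraceNormLE.comp_subtypeL {T : H →L[ℂ] W} {S : ℝ} (h : TraceNormLE T S)
    (U : Submodule ℂ H) [U.HasOrthogonalProjection] : TraceNormLE (T ∘L U.subtypeL) S :=
  fun n e w he hw => by
    refine h n (fun i => (e i : H)) w (fun x => ?_) hw
    calc ∑ i, ‖⟪(e i : H), x⟫_ℂ‖ ^ 2 = ∑ i, ‖⟪e i, U.orthogonalProjectionOnto x⟫_ℂ‖ ^ 2 := by
          refine Finset.sum_congr rfl fun i _ => ?_
          rw [Submodule.inner_orthogonalProjectionOnto_eq_of_mem_left]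
      _ ≤ ‖U.orthogonalProjectionOnto x‖ ^ 2 := he _
      _ ≤ ‖x‖ ^ 2 := by
          gcongr
          exact U.norm_orthogonalProjectionOnto_apply_le x

theorem Orthonormal.norm_sum_smul_sq {n : ℕ} {e : Fin n → H} (he : Orthonormal ℂ e)
    (c : Fin n → ℂ) : ‖∑ i, c i • e i‖ ^ 2 = ∑ i, ‖c i‖ ^ 2 := by
  have h := he.inner_sum c c Finset.univ
  rw [inner_self_eq_norm_sq_to_K] at h
  simp only [← Complex.normSq_eq_conj_mul_self, Complex.normSq_eq_norm_sq] at h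
  refine Complex.ofReal_injective ?_
  push_cast
  simpa using h

/-- If `R` is diagonal in the orthonormal family `e` with eigenvalues `r` and `T` is dominated by
`R`, then the vectors `r⁻¹ T e` satisfy Bessel's inequality. -/
theorem isBessel_inv_smul {n : ℕ} {e : Fin n → H} (he : Orthonormal ℂ e) {r : Fin n → ℝ}
    {R : H →L[ℂ] H} (hRe : ∀ i, R (e i) = (r i : ℂ) • e i) (T : H →L[ℂ] W)
    (hT : ∀ x, ‖T x‖ ≤ ‖R x‖) : IsBessel fun i => ((r i : ℂ)⁻¹) • T (e i) := by
  refine IsBessel.of_norm_sum_le fun c => ?_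
  have h1 : ∑ i, c i • (r i : ℂ)⁻¹ • T (e i) = T (∑ i, (c i * (r i : ℂ)⁻¹) • e i) := by
    simp [map_sum, smul_smul]
  have h2 : R (∑ i, (c i * (r i : ℂ)⁻¹) • e i)
      = ∑ i, (c i * (r i : ℂ)⁻¹ * (r i : ℂ)) • e i := by
    rw [map_sum]
    exact Finset.sum_congr rfl fun i _ => by rw [map_smul, hRe, smul_smul]
  rw [h1]
  calc ‖T (∑ i, (c i * (r i : ℂ)⁻¹) • e i)‖ ^ 2
      ≤ ‖R (∑ i, (c i * (r i : ℂ)⁻¹) • e i)‖ ^ 2 := by gcongr; exact hT _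
    _ = ∑ i, ‖c i * (r i : ℂ)⁻¹ * (r i : ℂ)‖ ^ 2 := by
        rw [h2, he.norm_sum_smul_sq]
    _ ≤ ∑ i, ‖c i‖ ^ 2 := by
        refine Finset.sum_le_sum fun i _ => ?_
        -- With `0⁻¹ = 0` the vectors in the kernel of `R` contribute nothing, so the kernel needs
        -- no separate treatment.
        by_cases h0 : (r i : ℂ) = 0
        · simp [h0]
        · rw [mul_assoc, inv_mul_cancel₀ h0, mul_one]

variable [CompleteSpace H]

/-- `K` is the sum of the rank one operators `⟪√K bᵢ, ·⟫ √K bᵢ`, whose trace norms `‖√K bᵢ‖² = ⟪bᵢ,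
K bᵢ⟫` add up to the trace. -/
theorem traceNormLE_of_nonneg {ι : Type*} [Fintype ι] (b : OrthonormalBasis ι ℂ H)
    {K : H →L[ℂ] H} (hK : 0 ≤ K) :
    TraceNormLE K (∑ i, (⟪b i, K (b i)⟫_ℂ).re) := by
  have hs : CFC.sqrt K * CFC.sqrt K = K := CFC.sqrt_mul_sqrt_self K hK
  have hsym := (CFC.sqrt_nonneg K).isSelfAdjoint.isSymmetric
  have h1 : K = ∑ i, (innerSL ℂ (CFC.sqrt K (b i))).smulRight (CFC.sqrt K (b i)) := by
    ext x
    rw [sum_apply]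
    conv_lhs => rw [← hs]
    rw [mul_apply_eq_comp]
    conv_lhs => rw [← b.sum_repr' (CFC.sqrt K x), map_sum]
    refine Finset.sum_congr rfl fun i _ => ?_
    rw [map_smul, ContinuousLinearMap.smulRight_apply, innerSL_apply_apply]
    congr 1
    exact (hsym (b i) x).symm
  have h2 : ∀ i, (⟪b i, K (b i)⟫_ℂ).re
      = ‖innerSL ℂ (CFC.sqrt K (b i))‖ * ‖CFC.sqrt K (b i)‖ := fun i => by
    conv_lhs => rw [← hs]
    rw [mul_apply_eq_comp]
    have : ⟪b i, CFC.sqrt K (CFC.sqrt K (b i))⟫_ℂ = ⟪CFC.sqrt K (b i), CFC.sqrt K (b i)⟫_ℂ :=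
      (hsym _ _).symm
    rw [this, inner_self_eq_norm_sq_to_K, innerSL_apply_norm, ← sq]
    norm_cast
  simp only [h2]
  conv => arg 1; rw [h1]
  exact TraceNormLE.sum _ fun i _ => TraceNormLE.smulRight _ _

/-- In finite dimensions, `Tr √(K² + Ψ⋆Ψ) ≤ Tr K + ‖Ψ‖₁`. -/
theorem sum_inner_le_of_mul_self_eq [CompleteSpace W] [FiniteDimensional ℂ H] {ι : Type*} [Fintype ι]
    (b : OrthonormalBasis ι ℂ H) {K R : H →L[ℂ] H} {Ψ : H →L[ℂ] W} {S : ℝ} (hK : 0 ≤ K)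
    (hR : 0 ≤ R) (hΨ : TraceNormLE Ψ S)
    (hRK : R * R = K * K + (ContinuousLinearMap.adjoint Ψ) ∘L Ψ) :
    ∑ i, (⟪b i, R (b i)⟫_ℂ).re ≤ ∑ i, (⟪b i, K (b i)⟫_ℂ).re + S := by
  have hRsym := hR.isSelfAdjoint.isSymmetric
  have hKsym := hK.isSelfAdjoint.isSymmetric
  have hnorm : ∀ x, ‖R x‖ ^ 2 = ‖K x‖ ^ 2 + ‖Ψ x‖ ^ 2 := fun x => by
    have h1 : ⟪x, (R * R) x⟫_ℂ = ⟪x, (K * K + (ContinuousLinearMap.adjoint Ψ) ∘L Ψ) x⟫_ℂ := by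
      rw [hRK]
    rw [add_apply, inner_add_right, ContinuousLinearMap.comp_apply,
      ContinuousLinearMap.adjoint_inner_right, mul_apply_eq_comp,
      mul_apply_eq_comp] at h1
    have h2 : ⟪x, R (R x)⟫_ℂ = ⟪R x, R x⟫_ℂ := (hRsym _ _).symm
    have h3 : ⟪x, K (K x)⟫_ℂ = ⟪K x, K x⟫_ℂ := (hKsym _ _).symm
    rw [h2, h3] at h1
    simp only [inner_self_eq_norm_sq_to_K] at h1
    exact_mod_cast h1
  -- The trace of `R` is evaluated in an eigenbasis of `R`, where `rᵢ` can be divided out.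
  set n := Module.finrank ℂ H with hn
  set e := hRsym.eigenvectorBasis hn.symm with he
  set r := hRsym.eigenvalues hn.symm with hr
  have hRe : ∀ i, R (e i) = (r i : ℂ) • e i := fun i =>
    hRsym.apply_eigenvectorBasis hn.symm i
  have hKR : ∀ x, ‖K x‖ ≤ ‖R x‖ := fun x => by
    have := hnorm x
    exact (sq_le_sq₀ (norm_nonneg _) (norm_nonneg _)).1 (by nlinarith [sq_nonneg ‖Ψ x‖])
  have hΨR : ∀ x, ‖Ψ x‖ ≤ ‖R x‖ := fun x => by
    have := hnorm x
    exact (sq_le_sq₀ (norm_nonneg _) (norm_nonneg _)).1 (by nlinarith [sq_nonneg ‖K x‖])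
  have b1 := traceNormLE_of_nonneg b hK n e _ e.orthonormal.isBessel 
    (isBessel_inv_smul e.orthonormal hRe K hKR)
  have b2 := hΨ n e _ e.orthonormal.isBessel 
    (isBessel_inv_smul e.orthonormal hRe Ψ hΨR)
  have htr : ∑ i, ⟪b i, R (b i)⟫_ℂ = ∑ i, ⟪e i, R (e i)⟫_ℂ := by
    have h1 := LinearMap.trace_eq_sum_inner (R : H →ₗ[ℂ] H) b
    have h2 := LinearMap.trace_eq_sum_inner (R : H →ₗ[ℂ] H) e
    exact h1.symm.trans h2
  -- This is `rᵢ = rᵢ⁻¹ (‖K eᵢ‖² + ‖Ψ eᵢ‖²)`, written so that both sums have the form tested by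
  -- `TraceNormLE`. If `rᵢ = 0`, both sides vanish.
  have hsum : ∑ i, ⟪e i, R (e i)⟫_ℂ = ∑ i, ⟪((r i : ℂ)⁻¹) • K (e i), K (e i)⟫_ℂ
      + ∑ i, ⟪((r i : ℂ)⁻¹) • Ψ (e i), Ψ (e i)⟫_ℂ := by
    rw [← Finset.sum_add_distrib]
    refine Finset.sum_congr rfl fun i _ => ?_
    rw [inner_smul_left, inner_smul_left, inner_self_eq_norm_sq_to_K, inner_self_eq_norm_sq_to_K,
      ← mul_add]
    have h1 := hnorm (e i)
    have h2 : ‖R (e i)‖ ^ 2 = r i ^ 2 := by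
      rw [hRe, norm_smul, e.norm_eq_one, mul_one, Complex.norm_real, Real.norm_eq_abs, sq_abs]
    have h3 : ((‖K (e i)‖ : ℂ)) ^ 2 + ((‖Ψ (e i)‖ : ℂ)) ^ 2 = (r i : ℂ) ^ 2 := by
      rw [← Complex.ofReal_pow, ← Complex.ofReal_pow, ← Complex.ofReal_add, ← h1, h2]
      norm_cast
    change _ = (starRingEnd ℂ) ((r i : ℂ)⁻¹) * ((‖K (e i)‖ : ℂ) ^ 2 + (‖Ψ (e i)‖ : ℂ) ^ 2)
    rw [h3, hRe, inner_smul_right, inner_self_eq_norm_sq_to_K, e.norm_eq_one, map_inv₀,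
      Complex.conj_ofReal]
    by_cases h0 : (r i : ℂ) = 0
    · simp [h0]
    · field_simp
      simp
  rw [← Complex.re_sum, htr, hsum, Complex.add_re]
  exact add_le_add ((Complex.re_le_norm _).trans b1) ((Complex.re_le_norm _).trans b2)

end TraceNorm

/-! ### Strong continuity of the square root -/

section StrongSqrt

variable {H : Type*} [NormedAddCommGroup H] [InnerProductSpace ℂ H]
  {ι : Type*} {F : Filter ι}

/-- Strong convergence passes to products only because of the uniform norm bound: `Bⁿ⁺¹x - B₀ⁿ⁺¹x =
B(Bⁿx - B₀ⁿx) + (B - B₀)B₀ⁿx`. -/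
theorem tendsto_pow_apply {B : ι → H →L[ℂ] H} {B₀ : H →L[ℂ] H} {M : ℝ} (hM : ∀ i, ‖B i‖ ≤ M)
    (h : ∀ x, Tendsto (fun i => B i x) F (𝓝 (B₀ x))) (n : ℕ) (x : H) :
    Tendsto (fun i => (B i ^ n) x) F (𝓝 ((B₀ ^ n) x)) := by
  induction n with
  | zero => simpa using tendsto_const_nhds
  | succ n ih =>
    simp only [pow_succ', mul_apply_eq_comp]
    have h1 : Tendsto (fun i => B i ((B i ^ n) x - (B₀ ^ n) x)) F (𝓝 0) := by
      refine squeeze_zero_norm (a := fun i => M * ‖(B i ^ n) x - (B₀ ^ n) x‖) (fun i => ?_) ?_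
      · exact ((B i).le_opNorm _).trans (by gcongr; exact hM i)
      · simpa using ((ih.sub_const ((B₀ ^ n) x)).norm).const_mul M
    simpa using h1.add (h ((B₀ ^ n) x))

theorem tendsto_aeval_apply {B : ι → H →L[ℂ] H} {B₀ : H →L[ℂ] H} {M : ℝ} (hM : ∀ i, ‖B i‖ ≤ M)
    (h : ∀ x, Tendsto (fun i => B i x) F (𝓝 (B₀ x))) (p : Polynomial ℝ) (x : H) :
    Tendsto (fun i => (Polynomial.aeval (B i) p) x) F (𝓝 ((Polynomial.aeval B₀ p) x)) := by
  simp only [Polynomial.aeval_eq_sum_range, sum_apply,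
    smul_apply]
  exact tendsto_finsetSum _ fun n _ => (tendsto_pow_apply hM h n x).const_smul _

variable [CompleteSpace H]

theorem norm_sqrt_sub_aeval_le {B : H →L[ℂ] H} (hB : 0 ≤ B) {M ε : ℝ} (hM : ‖B‖ ≤ M)
    (hε : 0 ≤ ε) (p : Polynomial ℝ) (hp : ∀ t ∈ Set.Icc 0 M, |p.eval t - √t| ≤ ε) :
    ‖CFC.sqrt B - Polynomial.aeval B p‖ ≤ ε := by
  have hsa : IsSelfAdjoint B := hB.isSelfAdjoint
  rw [CFC.sqrt_eq_real_sqrt B hB, cfcₙ_eq_cfc, ← cfc_polynomial p B, ← cfc_sub Real.sqrt p.eval B]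
  refine norm_cfc_le hε fun t ht => ?_
  rw [Real.norm_eq_abs, abs_sub_comm]
  refine hp t ⟨spectrum_nonneg_of_nonneg hB ht, ?_⟩
  have h1 := spectrum.norm_le_norm_mul_of_mem ht
  have h2 : ‖(1 : H →L[ℂ] H)‖ ≤ 1 := ContinuousLinearMap.norm_id_le
  calc t ≤ ‖t‖ := le_abs_self t
    _ ≤ ‖B‖ * ‖(1 : H →L[ℂ] H)‖ := h1
    _ ≤ ‖B‖ * 1 := by gcongr
    _ ≤ M := by rwa [mul_one]

/-- The square root is continuous in the strong topology on bounded sets. -/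
theorem tendsto_sqrt_apply {B : ι → H →L[ℂ] H} {B₀ : H →L[ℂ] H} {M : ℝ} (hB : ∀ i, 0 ≤ B i)
    (hB₀ : 0 ≤ B₀) (hM : ∀ i, ‖B i‖ ≤ M) (hM₀ : ‖B₀‖ ≤ M)
    (h : ∀ x, Tendsto (fun i => B i x) F (𝓝 (B₀ x))) (x : H) :
    Tendsto (fun i => CFC.sqrt (B i) x) F (𝓝 (CFC.sqrt B₀ x)) := by
  rw [Metric.tendsto_nhds]
  intro ε hε
  set δ := ε / (3 * (‖x‖ + 1)) with hδ
  have hδ0 : 0 < δ := by positivity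
  have hδx : δ * ‖x‖ < ε / 3 := by
    rw [hδ, div_mul_eq_mul_div, div_lt_div_iff₀ (by positivity) (by norm_num)]
    nlinarith [norm_nonneg x]
  -- By Weierstrass, one polynomial approximates the square root on `[0, M]`, hence for all the
  -- operators at once, as their spectra lie in this interval.
  obtain ⟨p, hp⟩ := exists_polynomial_near_of_continuousOn 0 M Real.sqrt
    Real.continuous_sqrt.continuousOn δ hδ0
  have happ : ∀ A : H →L[ℂ] H, 0 ≤ A → ‖A‖ ≤ M →
      ‖CFC.sqrt A x - (Polynomial.aeval A p) x‖ < ε / 3 := fun A hA hAM => by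
    rw [← sub_apply]
    refine lt_of_le_of_lt (ContinuousLinearMap.le_opNorm _ _) (lt_of_le_of_lt ?_ hδx)
    gcongr
    exact norm_sqrt_sub_aeval_le hA hAM hδ0.le p fun t ht => (hp t ht).le
  filter_upwards [Metric.tendsto_nhds.1 (tendsto_aeval_apply hM h p x) (ε / 3) (by positivity)]
    with i hi
  rw [dist_eq_norm] at hi ⊢
  have e : CFC.sqrt (B i) x - CFC.sqrt B₀ x
      = (CFC.sqrt (B i) x - (Polynomial.aeval (B i) p) x)
        + ((Polynomial.aeval (B i) p) x - (Polynomial.aeval B₀ p) x)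
        - (CFC.sqrt B₀ x - (Polynomial.aeval B₀ p) x) := by abel
  rw [e]
  refine lt_of_le_of_lt (norm_sub_le _ _) ?_
  have := norm_add_le (CFC.sqrt (B i) x - (Polynomial.aeval (B i) p) x)
    ((Polynomial.aeval (B i) p) x - (Polynomial.aeval B₀ p) x)
  linarith [happ (B i) (hB i) (hM i), happ B₀ hB₀ hM₀]

end StrongSqrt

/-! ### The trace of `√(K² + Ψ⋆Ψ) - K` -/

section TraceSqrtDiff

variable {H W : Type*} [NormedAddCommGroup H] [InnerProductSpace ℂ H]
  [NormedAddCommGroup W] [InnerProductSpace ℂ W]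

theorem tendsto_apply_of_norm_le_one {ι : Type*} {F : Filter ι} {P : ι → H →L[ℂ] H}
    (hP1 : ∀ i, ‖P i‖ ≤ 1) (hP : ∀ x, Tendsto (fun i => P i x) F (𝓝 x)) {y : ι → H} {y₀ : H}
    (hy : Tendsto y F (𝓝 y₀)) : Tendsto (fun i => P i (y i)) F (𝓝 y₀) := by
  have h1 : Tendsto (fun i => P i (y i - y₀)) F (𝓝 0) := by
    refine squeeze_zero_norm (a := fun i => ‖y i - y₀‖) (fun i => ?_) ?_
    · refine ((P i).le_opNorm _).trans ?_
      exact mul_le_of_le_one_left (norm_nonneg _) (hP1 i)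
    · simpa using (hy.sub_const y₀).norm
  simpa using h1.add (hP y₀)

variable [CompleteSpace H] [CompleteSpace W]

theorem adjoint_comp_self_nonneg (T : H →L[ℂ] W) : 0 ≤ (ContinuousLinearMap.adjoint T) ∘L T := by
  rw [ContinuousLinearMap.nonneg_iff_isPositive]
  exact ContinuousLinearMap.isPositive_adjoint_comp_self _

theorem conj_adjoint_nonneg {T : H →L[ℂ] H} (hT : 0 ≤ T) (S : H →L[ℂ] W) :
    0 ≤ S ∘L T ∘L ContinuousLinearMap.adjoint S := by
  rw [ContinuousLinearMap.nonneg_iff_isPositive] at *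
  exact hT.conj_adjoint S

theorem adjoint_conj_nonneg {T : H →L[ℂ] H} (hT : 0 ≤ T) (S : W →L[ℂ] H) :
    0 ≤ ContinuousLinearMap.adjoint S ∘L T ∘L S := by
  rw [ContinuousLinearMap.nonneg_iff_isPositive] at *
  exact hT.adjoint_conj S

theorem mul_self_add_nonneg {K A : H →L[ℂ] H} (hK : 0 ≤ K) (hA : 0 ≤ A) : 0 ≤ K * K + A :=
  add_nonneg hK.isSelfAdjoint.mul_self_nonneg hA

/-- As `J⋆J = 1`, the candidate squares correctly; a nonnegative square root is unique. -/
theorem sqrt_conj_isometry (J : W →L[ℂ] H)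
    (hJ : ∀ y, ContinuousLinearMap.adjoint J (J y) = y) {B : W →L[ℂ] W} (hB : 0 ≤ B) :
    CFC.sqrt (J ∘L B ∘L ContinuousLinearMap.adjoint J)
      = J ∘L CFC.sqrt B ∘L ContinuousLinearMap.adjoint J := by
  have h0 : 0 ≤ J ∘L CFC.sqrt B ∘L ContinuousLinearMap.adjoint J :=
    conj_adjoint_nonneg (CFC.sqrt_nonneg B) J
  refine CFC.sqrt_unique ?_ h0
  ext y
  simp only [mul_apply_eq_comp, ContinuousLinearMap.comp_apply, hJ]
  have h := DFunLike.congr_fun (CFC.sqrt_mul_sqrt_self B hB) (ContinuousLinearMap.adjoint J y)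
  rw [mul_apply_eq_comp] at h
  rw [h]

/-- The square root taken on the subspace is rewritten as a square root on the fixed space `H`,
where strong limits along growing subspaces make sense. -/
theorem apply_sqrtDiff_compression (J : W →L[ℂ] H)
    (hJ : ∀ y, ContinuousLinearMap.adjoint J (J y) = y) {P K A : H →L[ℂ] H}
    (hP : ∀ y, J (ContinuousLinearMap.adjoint J y) = P y) (hK : 0 ≤ K) (hA : 0 ≤ A) (x : W) :
    J (sqrtDiff (ContinuousLinearMap.adjoint J ∘L K ∘L J)
        (ContinuousLinearMap.adjoint J ∘L A ∘L J) x)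
      = CFC.sqrt (P * (K * P * K + A) * P) (J x) - P (K (J x)) := by
  set J' := ContinuousLinearMap.adjoint J with hJ'
  set KU := J' ∘L K ∘L J with hKU
  set AU := J' ∘L A ∘L J with hAU
  have hB0 : 0 ≤ KU * KU + AU :=
    mul_self_add_nonneg (adjoint_conj_nonneg hK _) (adjoint_conj_nonneg hA _)
  have h1 : CFC.sqrt (P * (K * P * K + A) * P) = J ∘L CFC.sqrt (KU * KU + AU) ∘L J' := by
    rw [← sqrt_conj_isometry J hJ hB0]
    congr 1
    ext y
    simp only [mul_apply_eq_comp, ContinuousLinearMap.comp_apply, add_apply, hKU, hAU, hP, map_add,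
      ← hJ']
  rw [h1, ContinuousLinearMap.comp_apply, ContinuousLinearMap.comp_apply, hJ, ← hP, sqrtDiff,
    sub_apply, map_sub]
  rfl

/-- The operator `√(K² + A) - K` for the compressions `K`, `A` to a subspace. -/
noncomputable def compressedSqrtDiff (U : Submodule ℂ H) [U.HasOrthogonalProjection]
    [CompleteSpace U] (K A : H →L[ℂ] H) : U →L[ℂ] U :=
  sqrtDiff (ContinuousLinearMap.adjoint U.subtypeL ∘L K ∘L U.subtypeL)
    (ContinuousLinearMap.adjoint U.subtypeL ∘L A ∘L U.subtypeL)


theorem subtypeL_comp_adjoint (U : Submodule ℂ H) [U.HasOrthogonalProjection]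
    [CompleteSpace U] : U.subtypeL ∘L ContinuousLinearMap.adjoint U.subtypeL
    = U.starProjection := by
  rw [Submodule.adjoint_subtypeL]
  rfl

theorem adjoint_subtypeL_apply_mem (U : Submodule ℂ H) [CompleteSpace U] (x : U) :
    ContinuousLinearMap.adjoint U.subtypeL (x : H) = x := by
  rw [Submodule.adjoint_subtypeL]
  simp

variable (U : Submodule ℂ H) [U.HasOrthogonalProjection] [CompleteSpace U]

theorem compressedSqrtDiff_nonneg {K A : H →L[ℂ] H} (hK : 0 ≤ K) (hA : 0 ≤ A) :
    0 ≤ compressedSqrtDiff U K A :=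
  sqrtDiff_nonneg (adjoint_conj_nonneg hK _) (adjoint_conj_nonneg hA _)

theorem coe_compressedSqrtDiff_apply {K A : H →L[ℂ] H} (hK : 0 ≤ K) (hA : 0 ≤ A) (x : U) :
    (compressedSqrtDiff U K A x : H)
      = CFC.sqrt (U.starProjection * (K * U.starProjection * K + A) * U.starProjection) x
        - U.starProjection (K x) := by
  exact apply_sqrtDiff_compression U.subtypeL (adjoint_subtypeL_apply_mem U)
    (fun y => by rw [← subtypeL_comp_adjoint]; rfl) hK hA x

/-- The compression of `Ψ⋆Ψ` is again of the form `Ψ'⋆Ψ'`, with `Ψ'` the restriction of `Ψ` to `U`,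
so the finite-dimensional inequality applies with the same `S`. -/
theorem sum_inner_compressedSqrtDiff_le [FiniteDimensional ℂ U] {ι : Type*} [Fintype ι]
    (b : OrthonormalBasis ι ℂ U) {K : H →L[ℂ] H} {Ψ : H →L[ℂ] W} {S : ℝ} (hK : 0 ≤ K)
    (hΨ : TraceNormLE Ψ S) :
    ∑ i, (⟪b i, compressedSqrtDiff U K (ContinuousLinearMap.adjoint Ψ ∘L Ψ) (b i)⟫_ℂ).re ≤ S := by
  set KU := ContinuousLinearMap.adjoint U.subtypeL ∘L K ∘L U.subtypeL with hKU
  have hKU0 : 0 ≤ KU := adjoint_conj_nonneg hK _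
  have hA : ContinuousLinearMap.adjoint U.subtypeL ∘L
      (ContinuousLinearMap.adjoint Ψ ∘L Ψ) ∘L U.subtypeL
      = ContinuousLinearMap.adjoint (Ψ ∘L U.subtypeL) ∘L (Ψ ∘L U.subtypeL) := by
    rw [ContinuousLinearMap.adjoint_comp]
    rfl
  have h := sum_inner_le_of_mul_self_eq b hKU0 (CFC.sqrt_nonneg _) (hΨ.comp_subtypeL U)
    (CFC.sqrt_mul_sqrt_self _ (mul_self_add_nonneg hKU0
      (adjoint_comp_self_nonneg _)))
  unfold compressedSqrtDiff sqrtDiff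
  rw [hA]
  simp only [sub_apply, inner_sub_right, Complex.sub_re, Finset.sum_sub_distrib]
  linarith

/-- `Tr (√(K² + Ψ⋆Ψ) - K) ≤ ‖Ψ‖₁`. -/
theorem opTrace_sqrtDiff_le {K : H →L[ℂ] H} {Ψ : H →L[ℂ] W} {S : ℝ} (hK : 0 ≤ K)
    (hΨ : TraceNormLE Ψ S) :
    opTrace (sqrtDiff K (ContinuousLinearMap.adjoint Ψ ∘L Ψ)) ≤ ENNReal.ofReal S := by
  classical
  set A := ContinuousLinearMap.adjoint Ψ ∘L Ψ with hAdef
  have hA : 0 ≤ A := adjoint_comp_self_nonneg _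
  obtain ⟨b, hb⟩ := (exists_hilbertBasis ℂ H).choose_spec
  rw [opTrace_eq_tsum _ (sqrtDiff_nonneg hK hA) b]
  have hpos : ∀ i, 0 ≤ (⟪b i, sqrtDiff K A (b i)⟫_ℂ).re := fun i => by
    have := sqrtDiff_nonneg hK hA
    rw [ContinuousLinearMap.nonneg_iff_isPositive] at this
    exact this.re_inner_nonneg_right (b i)
  refine (ENNReal.summable.tsum_le_of_sum_le fun F => ?_)
  rw [← ENNReal.ofReal_sum_of_nonneg fun i _ => hpos i]
  refine ENNReal.ofReal_le_ofReal ?_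
  -- With `F` fixed, the operators are compressed to the spans of finite sets `G ⊇ F` of basis
  -- vectors; the limit in `G` recovers the sum over `F`.
  set U : Finset (exists_hilbertBasis ℂ H).choose → Submodule ℂ H :=
    fun G => Submodule.span ℂ (G.image b : Set H) with hU
  have hUmono : Monotone U := fun G G' h => Submodule.span_mono (by
    exact_mod_cast Finset.image_subset_image h)
  set P : Finset (exists_hilbertBasis ℂ H).choose → H →L[ℂ] H :=
    fun G => (U G).starProjection with hPdef
  have hP1 : ∀ G, ‖P G‖ ≤ 1 := fun G => (U G).starProjection_norm_le
  have hP : ∀ x, Tendsto (fun G => P G x) atTop (𝓝 x) := fun x =>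
    Submodule.starProjection_tendsto_self U hUmono x (top_le_iff.2 b.finite_spans_dense)
  -- The square of the compression `PKP` is `PKPKP`, not `PK²P`; hence the inner projection, which
  -- disappears in the strong limit.
  set B := fun G => P G * (K * P G * K + A) * P G with hB
  have hB0 : ∀ G, 0 ≤ B G := fun G => by
    have hPsa : ContinuousLinearMap.adjoint (P G) = P G :=
      (isSelfAdjoint_starProjection (U G))
    have hKPK : 0 ≤ K * P G * K := by
      have h := conj_adjoint_nonneg (T := P G) (by
        exact isStarProjection_starProjection.nonneg) K
      have hKsa : ContinuousLinearMap.adjoint K = K := hK.isSelfAdjoint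
      rwa [hKsa] at h
    have h := conj_adjoint_nonneg (add_nonneg hKPK hA) (P G)
    rwa [hPsa] at h
  have hBM : ∀ G, ‖B G‖ ≤ ‖K‖ * ‖K‖ + ‖A‖ := fun G => by
    calc ‖B G‖ ≤ ‖P G‖ * ‖K * P G * K + A‖ * ‖P G‖ :=
          (norm_mul_le _ _).trans (by gcongr; exact norm_mul_le _ _)
      _ ≤ 1 * ‖K * P G * K + A‖ * 1 := by gcongr <;> exact hP1 G
      _ ≤ ‖K‖ * ‖P G‖ * ‖K‖ + ‖A‖ := by
          rw [one_mul, mul_one]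
          refine (norm_add_le _ _).trans (add_le_add_left ?_ _)
          exact (norm_mul_le _ _).trans (by gcongr; exact norm_mul_le _ _)
      _ ≤ ‖K‖ * 1 * ‖K‖ + ‖A‖ := by gcongr; exact hP1 G
      _ = _ := by ring
  have hBlim : ∀ x, Tendsto (fun G => B G x) atTop (𝓝 ((K * K + A) x)) := fun x => by
    have h1 := hP x
    have h2 : Tendsto (fun G => K (P G (K (P G x)))) atTop (𝓝 (K (K x))) :=
      (K.continuous.tendsto _).comp (tendsto_apply_of_norm_le_one hP1 hP
        ((K.continuous.tendsto _).comp h1))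
    have h3 : Tendsto (fun G => A (P G x)) atTop (𝓝 (A x)) := (A.continuous.tendsto _).comp h1
    exact tendsto_apply_of_norm_le_one hP1 hP (h2.add h3)
  have hlim : ∀ x, Tendsto (fun G => CFC.sqrt (B G) x) atTop (𝓝 (CFC.sqrt (K * K + A) x)) :=
    tendsto_sqrt_apply hB0 (mul_self_add_nonneg hK hA) hBM
      ((norm_add_le _ _).trans (add_le_add_left (norm_mul_le _ _) _)) hBlim
  have hD : ∀ x, Tendsto (fun G => CFC.sqrt (B G) x - P G (K x)) atTop
      (𝓝 (sqrtDiff K A x)) := fun x => (hlim x).sub (hP (K x))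
  have hsum : Tendsto (fun G => ∑ i ∈ F, (⟪b i, CFC.sqrt (B G) (b i) - P G (K (b i))⟫_ℂ).re)
      atTop (𝓝 (∑ i ∈ F, (⟪b i, sqrtDiff K A (b i)⟫_ℂ).re)) :=
    tendsto_finsetSum _ fun i _ =>
      (Complex.continuous_re.tendsto _).comp (tendsto_const_nhds.inner (hD (b i)))
  refine le_of_tendsto hsum ?_
  filter_upwards [eventually_ge_atTop F] with G hG
  set β := OrthonormalBasis.span b.orthonormal G with hβ
  have hβi : ∀ i : G, (β i : H) = b i := fun i => OrthonormalBasis.span_apply b.orthonormal G i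
  have hterm : ∀ i : G, (⟪b i, CFC.sqrt (B G) (b i) - P G (K (b i))⟫_ℂ).re
      = (⟪β i, compressedSqrtDiff (U G) K A (β i)⟫_ℂ).re := fun i => by
    rw [Submodule.coe_inner, coe_compressedSqrtDiff_apply (U G) hK hA, hβi]
  have hnn : ∀ i : G, 0 ≤ (⟪β i, compressedSqrtDiff (U G) K A (β i)⟫_ℂ).re := fun i => by
    have := compressedSqrtDiff_nonneg (U G) hK hA
    rw [ContinuousLinearMap.nonneg_iff_isPositive] at this
    exact this.re_inner_nonneg_right (β i)
  -- The compressed operator is nonnegative, so the sum may be enlarged from `F` to `G`, where it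
  -- becomes a full trace over the span.
  calc ∑ i ∈ F, (⟪b i, CFC.sqrt (B G) (b i) - P G (K (b i))⟫_ℂ).re
      ≤ ∑ i ∈ G, (⟪b i, CFC.sqrt (B G) (b i) - P G (K (b i))⟫_ℂ).re := by
        refine Finset.sum_le_sum_of_subset_of_nonneg hG fun i hi _ => ?_
        rw [hterm ⟨i, hi⟩]
        exact hnn _
    _ = ∑ i : G, (⟪β i, compressedSqrtDiff (U G) K A (β i)⟫_ℂ).re := by
        rw [← Finset.sum_coe_sort]
        exact Finset.sum_congr rfl fun i _ => hterm i
    _ ≤ S := sum_inner_compressedSqrtDiff_le (U G) β hK hΨ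

end TraceSqrtDiff

/-! ### Translation estimate for weakly differentiable functions -/

section Translation

theorem abs_integral_mul_le_toReal_eLpNorm {X : Type*} [MeasurableSpace X] {μ : Measure X}
    {f g : X → ℝ} (hf : MemLp f 2 μ) (hg : MemLp g 2 μ) :
    |∫ x, f x * g x ∂μ| ≤ (eLpNorm f 2 μ).toReal * (eLpNorm g 2 μ).toReal := by
  have h := abs_real_inner_le_norm (hf.toLp f) (hg.toLp g)
  rw [L2.inner_def, Lp.norm_toLp, Lp.norm_toLp] at h
  refine le_trans (le_of_eq ?_) h
  congr 1
  refine integral_congr_ae ?_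
  filter_upwards [hf.coeFn_toLp, hg.coeFn_toLp] with x h1 h2
  rw [h1, h2]
  simp [mul_comm]

theorem abs_integral_inner_mul_le (g : Lp E3 2 (volume : Measure E3)) {ψ : E3 → ℝ}
    (hψ : MemLp ψ 2 volume) (v : E3) :
    |∫ x, ⟪g x, v⟫_ℝ * ψ x| ≤ ‖g‖ * ‖v‖ * (eLpNorm ψ 2 volume).toReal := by
  have hgv : MemLp (fun x => ⟪g x, v⟫_ℝ) 2 volume := (Lp.memLp g).inner_const v
  refine (abs_integral_mul_le_toReal_eLpNorm hgv hψ).trans ?_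
  gcongr
  have h1 : eLpNorm (fun x => ⟪g x, v⟫_ℝ) 2 volume ≤ ENNReal.ofReal ‖v‖ * eLpNorm g 2 volume :=
    eLpNorm_le_mul_eLpNorm_of_ae_le_mul (Eventually.of_forall fun x => by
      rw [mul_comm]; exact norm_inner_le_norm _ _) _
  have h2 := ENNReal.toReal_mono
    (ENNReal.mul_ne_top ENNReal.ofReal_ne_top (Lp.eLpNorm_ne_top g)) h1
  rw [ENNReal.toReal_mul, ENNReal.toReal_ofReal (norm_nonneg _)] at h2
  rw [Lp.norm_def, mul_comm]
  exact h2

theorem eLpNorm_sub_left (ψ : E3 → ℝ) (hψ : Continuous ψ) (y : E3) :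
    eLpNorm (fun x => ψ (y - x)) 2 volume = eLpNorm ψ 2 volume :=
  eLpNorm_comp_measurePreserving hψ.aestronglyMeasurable
    (Measure.measurePreserving_sub_left volume y)

/-- A test function paired with the difference of a translate of a weakly differentiable
function. -/
theorem abs_integral_translate_sub_mul_le {φ : Lp ℝ 2 (volume : Measure E3)}
    {g : Lp E3 2 (volume : Measure E3)} (h : IsWeakGradient φ g) (v : E3) {ψ : E3 → ℝ}
    (hψ : ContDiff ℝ ∞ ψ) (hψc : HasCompactSupport ψ) :
    |∫ x, (φ (x + v) - φ x) * ψ x| ≤ ‖g‖ * ‖v‖ * (eLpNorm ψ 2 volume).toReal := by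
  -- With the reflected test function, `(φ * ρ)(v) = ∫ φ(x + v) ψ(x) dx`. The left side is thus an
  -- increment of a `C¹` function whose derivative falls on `ρ`.
  set ρ : E3 → ℝ := fun x => ψ (-x) with hρ
  have hρs : ContDiff ℝ ∞ ρ := hψ.comp contDiff_neg
  have hρc : HasCompactSupport ρ := hψc.comp_homeomorph (Homeomorph.neg E3)
  have hρn : eLpNorm ρ 2 volume = eLpNorm ψ 2 volume :=
    eLpNorm_comp_measurePreserving hψ.continuous.aestronglyMeasurable
      (Measure.measurePreserving_neg volume)
  have hloc : LocallyIntegrable φ volume := (Lp.memLp φ).locallyIntegrable one_le_two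
  set Lm := ContinuousLinearMap.mul ℝ ℝ
  set Fc : E3 → ℝ := convolution φ ρ Lm volume with hFc
  have hderiv : ∀ y, HasFDerivAt Fc (convolution φ (fderiv ℝ ρ) (Lm.precompR E3) volume y) y :=
    fun y => hρc.hasFDerivAt_convolution_right Lm hloc (hρs.of_le (by simp)) y
  have hbound : ∀ y, ‖convolution φ (fderiv ℝ ρ) (Lm.precompR E3) volume y‖
      ≤ ‖g‖ * (eLpNorm ψ 2 volume).toReal := fun y => by
    refine ContinuousLinearMap.opNorm_le_bound _ (by positivity) fun w => ?_
    rw [convolution_precompR_apply Lm hloc (hρc.fderiv ℝ)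
      (hρs.continuous_fderiv (by simp))]
    set Ψ : E3 → ℝ := fun x => ρ (y - x) with hΨ
    have hΨs : ContDiff ℝ ∞ Ψ := hρs.comp (contDiff_const.sub contDiff_id)
    have hΨc : HasCompactSupport Ψ := hρc.comp_homeomorph (Homeomorph.subLeft y)
    -- This sign cancels the one in the definition of the weak gradient.
    have hΨd : ∀ x, fderiv ℝ Ψ x w = - fderiv ℝ ρ (y - x) w := fun x => by
      have h1 : HasFDerivAt Ψ ((fderiv ℝ ρ (y - x)).comp (-(ContinuousLinearMap.id ℝ E3))) x :=
        HasFDerivAt.comp (g := ρ) x ((hρs.differentiable (by simp)) (y - x)).hasFDerivAt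
          ((hasFDerivAt_id x).const_sub y)
      rw [h1.fderiv]
      simp
    have h2 := h Ψ hΨs hΨc w
    simp only [hΨd, mul_neg, integral_neg, neg_inj] at h2
    have h3 : convolution φ (fun a => fderiv ℝ ρ a w) Lm volume y
        = ∫ x, φ x * fderiv ℝ ρ (y - x) w := rfl
    rw [h3, h2, Real.norm_eq_abs]
    refine (abs_integral_inner_mul_le g (hΨs.continuous.memLp_of_hasCompactSupport hΨc) w).trans
      (le_of_eq ?_)
    rw [hΨ, eLpNorm_sub_left ρ hρs.continuous, hρn]
    ring
  have hmv := convex_univ.norm_image_sub_le_of_norm_hasFDerivWithin_le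
    (fun y _ => (hderiv y).hasFDerivWithinAt) (fun y _ => hbound y)
    (Set.mem_univ (0 : E3)) (Set.mem_univ v)
  have hρm : ∀ y, MemLp (fun x => ρ (y - x)) 2 volume := fun y =>
    (hρs.continuous.comp (continuous_const.sub continuous_id)).memLp_of_hasCompactSupport
      (hρc.comp_homeomorph (Homeomorph.subLeft y))
  have hval : Fc v - Fc 0 = ∫ x, (φ (x + v) - φ x) * ψ x := by
    have e1 : Fc v = ∫ x, φ (x + v) * ψ x := by
      have : Fc v = ∫ x, φ x * ρ (v - x) := rfl
      rw [this, ← integral_add_right_eq_self _ v]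
      refine integral_congr_ae (Eventually.of_forall fun x => ?_)
      simp [hρ]
    have e0 : Fc 0 = ∫ x, φ x * ψ x := by
      have : Fc 0 = ∫ x, φ x * ρ (0 - x) := rfl
      rw [this]
      refine integral_congr_ae (Eventually.of_forall fun x => ?_)
      simp [hρ]
    have hψm : MemLp ψ 2 volume := hψ.continuous.memLp_of_hasCompactSupport hψc
    rw [e1, e0, ← integral_sub]
    · simp only [sub_mul]
    · exact MemLp.integrable_mul
        ((Lp.memLp φ).comp_measurePreserving (measurePreserving_add_right volume v)) hψm
    · exact MemLp.integrable_mul (Lp.memLp φ) hψm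
  rw [hval, sub_zero, Real.norm_eq_abs] at hmv
  exact hmv.trans (le_of_eq (by ring))

/-- Test functions are dense in `L²`, so the preceding bound extends to all `f ∈ L²`. Pairing the
difference with itself gives its norm. -/
theorem eLpNorm_translate_sub_le {φ : Lp ℝ 2 (volume : Measure E3)}
    {g : Lp E3 2 (volume : Measure E3)} (h : IsWeakGradient φ g) (v : E3) :
    eLpNorm (fun x => φ (x + v) - φ x) 2 volume ≤ ENNReal.ofReal (‖g‖ * ‖v‖) := by
  have hm : MemLp (fun x => φ (x + v) - φ x) 2 volume :=
    ((Lp.memLp φ).comp_measurePreserving (measurePreserving_add_right volume v)).sub (Lp.memLp φ)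
  set D := hm.toLp _ with hD
  have hall : ∀ f : Lp ℝ 2 (volume : Measure E3), |⟪D, f⟫_ℝ| ≤ ‖g‖ * ‖v‖ * ‖f‖ := by
    have hcl : IsClosed {f : Lp ℝ 2 (volume : Measure E3) | |⟪D, f⟫_ℝ| ≤ ‖g‖ * ‖v‖ * ‖f‖} :=
      isClosed_le (by fun_prop) (by fun_prop)
    have hdense := Lp.dense_hasCompactSupport_contDiff (E := E3) (F := ℝ)
      (μ := (volume : Measure E3)) (p := 2) (by simp)
    intro f
    refine hcl.closure_subset_iff.2 ?_ (hdense f)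
    rintro f ⟨ψ, hfψ, hψc, hψ⟩
    have h1 := abs_integral_translate_sub_mul_le h v hψ hψc
    change |⟪D, f⟫_ℝ| ≤ _
    rw [L2.inner_def, Lp.norm_def f, eLpNorm_congr_ae hfψ]
    refine le_trans (le_of_eq ?_) h1
    congr 1
    refine integral_congr_ae ?_
    filter_upwards [hm.coeFn_toLp, hfψ] with x h2 h3
    rw [hD, h2, h3]
    simp [mul_comm]
  have hDD := hall D
  rw [real_inner_self_eq_norm_sq, abs_of_nonneg (by positivity), sq] at hDD
  have hle : ‖D‖ ≤ ‖g‖ * ‖v‖ := by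
    rcases (norm_nonneg D).eq_or_lt with h0 | h0
    · rw [← h0]; positivity
    · exact le_of_mul_le_mul_right hDD h0
  rw [hD, Lp.norm_toLp] at hle
  exact (ENNReal.le_ofReal_iff_toReal_le hm.eLpNorm_ne_top (by positivity)).2 hle

end Translation

/-! ### Decomposition of space into cubes -/

section Cells

/-- The cube `∏ᵢ [2 zᵢ / Λ, 2 (zᵢ + 1) / Λ)`. -/
def cell (Λ : ℝ) (z : Fin 3 → ℤ) : Set E3 := {x | ∀ i, ⌊x i * (Λ / 2)⌋ = z i}

/-- The centre of a cube. -/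
noncomputable def cellCenter (Λ : ℝ) (z : Fin 3 → ℤ) : E3 :=
  WithLp.toLp 2 fun i => (2 * z i + 1) / Λ

variable {Λ : ℝ} {z : Fin 3 → ℤ}

theorem measurableSet_cell (Λ : ℝ) (z : Fin 3 → ℤ) : MeasurableSet (cell Λ z) := by
  have : cell Λ z = ⋂ i, (fun x : E3 => ⌊x i * (Λ / 2)⌋) ⁻¹' {z i} := by
    ext x; simp [cell]
  rw [this]
  refine MeasurableSet.iInter fun i => ?_
  have hm : Measurable fun x : E3 => x i * (Λ / 2) :=
    (by fun_prop : Continuous fun x : E3 => x i * (Λ / 2)).measurable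
  exact (Int.measurable_floor.comp hm) (measurableSet_singleton _)

theorem pairwise_disjoint_cell (Λ : ℝ) : Pairwise (Function.onFun Disjoint (cell Λ)) := by
  intro z z' h
  rw [Function.onFun, Set.disjoint_left]
  intro x hx hx'
  exact h (funext fun i => (hx i).symm.trans (hx' i))

theorem mem_cell_iff (hΛ : 0 < Λ) {x : E3} : x ∈ cell Λ z ↔
    ∀ i, x i ∈ Set.Ico (cellCenter Λ z i - 1 / Λ) (cellCenter Λ z i + 1 / Λ) := by
  have key : ∀ i, ⌊x i * (Λ / 2)⌋ = z i ↔
      x i ∈ Set.Ico (cellCenter Λ z i - 1 / Λ) (cellCenter Λ z i + 1 / Λ) := fun i => by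
    have e1 : cellCenter Λ z i - 1 / Λ = 2 * z i / Λ := by
      simp only [cellCenter]; ring
    have e2 : cellCenter Λ z i + 1 / Λ = 2 * (z i + 1) / Λ := by
      simp only [cellCenter]; ring
    rw [Int.floor_eq_iff, e1, e2, Set.mem_Ico, div_le_iff₀ hΛ, lt_div_iff₀ hΛ]
    constructor <;> rintro ⟨h1, h2⟩ <;> constructor <;> linarith
  exact forall_congr' key

theorem abs_sub_cellCenter_le (hΛ : 0 < Λ) {x : E3} (hx : x ∈ cell Λ z) (i : Fin 3) :
    |(x - cellCenter Λ z) i| ≤ 1 / Λ := by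
  have := (mem_cell_iff hΛ).1 hx i
  rw [PiLp.sub_apply, abs_le]
  constructor <;> linarith [this.1, this.2]

theorem norm_sub_cellCenter_le (hΛ : 0 < Λ) {x : E3} (hx : x ∈ cell Λ z) :
    ‖x - cellCenter Λ z‖ ≤ √3 / Λ := by
  rw [EuclideanSpace.norm_eq]
  have h : ∑ i, ‖(x - cellCenter Λ z) i‖ ^ 2 ≤ 3 * (1 / Λ) ^ 2 := by
    have : ∀ i, ‖(x - cellCenter Λ z) i‖ ^ 2 ≤ (1 / Λ) ^ 2 := fun i => by
      gcongr; exact abs_sub_cellCenter_le hΛ hx i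
    rw [Fin.sum_univ_three]
    linarith [this 0, this 1, this 2]
  calc √(∑ i, ‖(x - cellCenter Λ z) i‖ ^ 2) ≤ √(3 * (1 / Λ) ^ 2) := Real.sqrt_le_sqrt h
    _ = √3 / Λ := by
      rw [Real.sqrt_mul (by norm_num), Real.sqrt_sq (by positivity)]; ring

theorem norm_sub_le_of_mem_cell (hΛ : 0 < Λ) {x y : E3} (hx : x ∈ cell Λ z) (hy : y ∈ cell Λ z) :
    ‖x - y‖ ≤ 2 * √3 / Λ := by
  have e : x - y = (x - cellCenter Λ z) - (y - cellCenter Λ z) := by abel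
  rw [e]
  refine (norm_sub_le _ _).trans ?_
  have := norm_sub_cellCenter_le hΛ hx
  have := norm_sub_cellCenter_le hΛ hy
  have e2 : 2 * √3 / Λ = √3 / Λ + √3 / Λ := by ring
  linarith

theorem volume_cell_lt_top (hΛ : 0 < Λ) (z : Fin 3 → ℤ) : volume (cell Λ z) < ⊤ :=
  lt_of_le_of_lt (measure_mono (t := Metric.closedBall (cellCenter Λ z) (√3 / Λ)) fun x hx => by
    rw [mem_closedBall_iff_norm]
    exact norm_sub_cellCenter_le hΛ hx) measure_closedBall_lt_top

theorem integral_prod_coord (f : Fin 3 → ℝ → ℝ) :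
    ∫ x : E3, ∏ i, f i (x i) = ∏ i, ∫ t, f i t := by
  rw [← integral_fintype_prod_volume_eq_prod]
  exact (EuclideanSpace.volume_preserving_symm_measurableEquiv_toLp (Fin 3)).integral_comp'
    (fun y : Fin 3 → ℝ => ∏ i, f i (y i))

theorem setIntegral_cell_prod (hΛ : 0 < Λ) (f : Fin 3 → ℝ → ℝ) :
    ∫ x in cell Λ z, ∏ i, f i (x i)
      = ∏ i, ∫ t in Set.Ico (cellCenter Λ z i - 1 / Λ) (cellCenter Λ z i + 1 / Λ), f i t := by
  simp only [← integral_indicator measurableSet_Ico]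
  rw [← integral_prod_coord, ← integral_indicator (measurableSet_cell Λ z)]
  refine integral_congr_ae (Eventually.of_forall fun x => ?_)
  simp only
  by_cases hx : x ∈ cell Λ z
  · rw [Set.indicator_of_mem hx]
    exact Finset.prod_congr rfl fun i _ => by
      rw [Set.indicator_of_mem ((mem_cell_iff hΛ).1 hx i)]
  · rw [Set.indicator_of_notMem hx]
    rw [mem_cell_iff hΛ] at hx
    push Not at hx
    obtain ⟨i, hi⟩ := hx
    exact (Finset.prod_eq_zero (Finset.mem_univ i) (Set.indicator_of_notMem hi _)).symm

theorem volume_real_cell (hΛ : 0 < Λ) (z : Fin 3 → ℤ) :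
    volume.real (cell Λ z) = (2 / Λ) ^ 3 := by
  have h := setIntegral_cell_prod (z := z) hΛ fun _ _ => 1
  have hle : ∀ i, cellCenter Λ z i - 1 / Λ ≤ cellCenter Λ z i + 1 / Λ := fun i => by
    have : 0 < 1 / Λ := by positivity
    linarith
  simp only [Finset.prod_const_one, setIntegral_const, smul_eq_mul, mul_one] at h
  rw [h, Fin.prod_univ_three]
  simp only [Real.volume_real_Ico_of_le (hle _)]
  ring

theorem setIntegral_cell_sq_coord (hΛ : 0 < Λ) (z : Fin 3 → ℤ) (j : Fin 3) :
    ∫ x in cell Λ z, (x j - cellCenter Λ z j) ^ 2 = (2 / Λ) ^ 3 * (1 / Λ) ^ 2 / 3 := by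
  have h := setIntegral_cell_prod (z := z) hΛ
    fun i t => if i = j then (t - cellCenter Λ z j) ^ 2 else 1
  have hle : ∀ i, cellCenter Λ z i - 1 / Λ ≤ cellCenter Λ z i + 1 / Λ := fun i => by
    have : 0 < 1 / Λ := by positivity
    linarith
  have h1 : ∀ c : ℝ, c - 1 / Λ ≤ c + 1 / Λ →
      ∫ t in Set.Ico (c - 1 / Λ) (c + 1 / Λ), (t - c) ^ 2 = 2 / 3 * (1 / Λ) ^ 3 := fun c hc => by
    rw [integral_Ico_eq_integral_Ioc, ← intervalIntegral.integral_of_le hc,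
      intervalIntegral.integral_comp_sub_right (fun t => t ^ 2) c, integral_pow]
    ring
  simp only [Finset.prod_ite_eq', Finset.mem_univ, if_true] at h
  rw [h, ← Finset.mul_prod_erase _ _ (Finset.mem_univ j)]
  simp only [if_true]
  rw [h1 _ (hle j)]
  have h2 : ∀ i ∈ Finset.univ.erase j,
      ∫ t in Set.Ico (cellCenter Λ z i - 1 / Λ) (cellCenter Λ z i + 1 / Λ),
        (if i = j then (t - cellCenter Λ z j) ^ 2 else 1) = 2 / Λ := fun i hi => by
    simp only [Finset.ne_of_mem_erase hi, if_false, setIntegral_const, smul_eq_mul, mul_one]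
    rw [Real.volume_real_Ico_of_le (hle i)]
    ring
  rw [Finset.prod_congr rfl h2, Finset.prod_const, Finset.card_erase_of_mem (Finset.mem_univ j)]
  simp
  ring

theorem memLp_cell_of_continuous {f : E3 → ℝ} (hf : Continuous f) (hΛ : 0 < Λ) (z : Fin 3 → ℤ)
    (p : ℝ≥0∞) : MemLp f p (volume.restrict (cell Λ z)) := by
  have : IsFiniteMeasure (volume.restrict (cell Λ z)) :=
    isFiniteMeasure_restrict.2 (volume_cell_lt_top hΛ z).ne
  obtain ⟨C, hC⟩ := (isCompact_closedBall (cellCenter Λ z) (√3 / Λ)).exists_bound_of_continuousOn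
    hf.continuousOn
  refine MemLp.of_bound hf.aestronglyMeasurable C ?_
  filter_upwards [ae_restrict_mem (measurableSet_cell Λ z)] with x hx
  refine hC x ?_
  rw [mem_closedBall_iff_norm]
  exact norm_sub_cellCenter_le hΛ hx

theorem setIntegral_cell_norm_sq (hΛ : 0 < Λ) (z : Fin 3 → ℤ) :
    ∫ x in cell Λ z, ‖x - cellCenter Λ z‖ ^ 2 = (2 / Λ) ^ 3 * (1 / Λ) ^ 2 := by
  have e : ∀ x : E3, ‖x - cellCenter Λ z‖ ^ 2 = ∑ j, (x j - cellCenter Λ z j) ^ 2 := fun x => by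
    rw [EuclideanSpace.norm_sq_eq]
    simp
  simp only [e]
  rw [integral_finsetSum _ fun j _ =>
    memLp_one_iff_integrable.1 (memLp_cell_of_continuous (by fun_prop) hΛ z 1)]
  simp only [setIntegral_cell_sq_coord hΛ]
  simp
  ring

theorem eLpNorm_cell_one (hΛ : 0 < Λ) (z : Fin 3 → ℤ) (c : ℝ) :
    eLpNorm (fun _ => c) 2 (volume.restrict (cell Λ z))
      = ENNReal.ofReal (|c| * √((2 / Λ) ^ 3)) := by
  rw [eLpNorm_const' c (by simp) (by simp), Measure.restrict_apply_univ,
    ← ofReal_measureReal (volume_cell_lt_top hΛ z).ne, volume_real_cell hΛ,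
    Real.enorm_eq_ofReal_abs, ENNReal.ofReal_rpow_of_nonneg (by positivity) (by simp),
    ← ENNReal.ofReal_mul (abs_nonneg c), Real.sqrt_eq_rpow]
  simp

/-- The root mean square distance to the centre is exactly `1/Λ`, a factor `√3` below the half
diagonal. This gain is needed: using the half diagonal in all orders would replace `momentSum` by
`exp √3`, too large for the final constant. -/
theorem eLpNorm_cell_norm_sub (hΛ : 0 < Λ) (z : Fin 3 → ℤ) :
    eLpNorm (fun x : E3 => ‖x - cellCenter Λ z‖) 2 (volume.restrict (cell Λ z))
      = ENNReal.ofReal (√((2 / Λ) ^ 3) * (1 / Λ)) := by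
  have hm : MemLp (fun x : E3 => ‖x - cellCenter Λ z‖) 2 (volume.restrict (cell Λ z)) :=
    memLp_cell_of_continuous (by fun_prop) hΛ z 2
  rw [hm.eLpNorm_eq_integral_rpow_norm (by simp) (by simp)]
  congr 1
  simp only [norm_norm, ENNReal.toReal_ofNat, Real.rpow_ofNat]
  rw [setIntegral_cell_norm_sq hΛ, ← one_div, ← Real.sqrt_eq_rpow, Real.sqrt_mul (by positivity),
    Real.sqrt_sq (by positivity)]

/-- The coefficients bounding the normalised moments of a cube. -/
noncomputable def momentCoeff : ℕ → ℝ
  | 0 => 1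
  | n + 1 => √3 ^ n

theorem momentCoeff_nonneg (n : ℕ) : 0 ≤ momentCoeff n := by
  cases n <;> simp [momentCoeff]

/-- One factor is measured in `L²`, the others by the half diagonal `√3/Λ`. -/
theorem eLpNorm_cell_norm_sub_pow_le (hΛ : 0 < Λ) (z : Fin 3 → ℤ) (n : ℕ) :
    eLpNorm (fun x : E3 => ‖x - cellCenter Λ z‖ ^ n) 2 (volume.restrict (cell Λ z))
      ≤ ENNReal.ofReal (momentCoeff n * (1 / Λ) ^ n * √((2 / Λ) ^ 3)) := by
  cases n with
  | zero =>
    simp only [pow_zero, momentCoeff]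
    rw [eLpNorm_cell_one hΛ]
    simp
  | succ n =>
    have h : eLpNorm (fun x : E3 => ‖x - cellCenter Λ z‖ ^ (n + 1)) 2
        (volume.restrict (cell Λ z)) ≤ ENNReal.ofReal ((√3 / Λ) ^ n) *
          eLpNorm (fun x : E3 => ‖x - cellCenter Λ z‖) 2 (volume.restrict (cell Λ z)) := by
      refine eLpNorm_le_mul_eLpNorm_of_ae_le_mul ?_ _
      filter_upwards [ae_restrict_mem (measurableSet_cell Λ z)] with x hx
      rw [norm_pow, norm_norm, pow_succ]
      gcongr
      exact norm_sub_cellCenter_le hΛ hx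
    refine h.trans (le_of_eq ?_)
    rw [eLpNorm_cell_norm_sub hΛ, ← ENNReal.ofReal_mul (by positivity)]
    congr 1
    simp only [momentCoeff]
    rw [div_pow, pow_succ, one_div, inv_pow]
    ring

end Cells

/-! ### Local oscillation estimates -/

section Oscillation

variable {Λ : ℝ}

/-- The mean of a function over a cube. -/
noncomputable def cellAverage (Λ : ℝ) (φ : E3 → ℝ) (z : Fin 3 → ℤ) : ℝ :=
  ((2 / Λ) ^ 3)⁻¹ * ∫ x in cell Λ z, φ x

/-- The `L²`-norm of the deviation from the mean over a cube. -/
noncomputable def cellOscillation (Λ : ℝ) (φ : E3 → ℝ) (z : Fin 3 → ℤ) : ℝ≥0∞ :=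
  eLpNorm (fun x => φ x - cellAverage Λ φ z) 2 (volume.restrict (cell Λ z))

theorem abs_cellAverage_le (hΛ : 0 < Λ) (φ : E3 → ℝ) (z : Fin 3 → ℤ) :
    |cellAverage Λ φ z| ≤ ((2 / Λ) ^ 3)⁻¹ * ∫ x in cell Λ z, |φ x| := by
  unfold cellAverage
  rw [abs_mul, abs_of_nonneg (by positivity)]
  gcongr
  exact abs_integral_le_integral_abs

/-- Write `φ` as mean plus deviation. The mean meets the exact moments, which matter for the leading
constant; for the deviation the crude supremum is enough. -/
theorem eLpNorm_mul_norm_pow_le (hΛ : 0 < Λ) {φ : E3 → ℝ} (hφ : MemLp φ 2 volume)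
    (z : Fin 3 → ℤ) (n : ℕ) :
    eLpNorm (fun x => φ x * ‖x - cellCenter Λ z‖ ^ n) 2 (volume.restrict (cell Λ z))
      ≤ ENNReal.ofReal (|cellAverage Λ φ z| * (momentCoeff n * (1 / Λ) ^ n * √((2 / Λ) ^ 3)))
        + ENNReal.ofReal ((√3 / Λ) ^ n) * cellOscillation Λ φ z := by
  have hc : Continuous fun x : E3 => ‖x - cellCenter Λ z‖ ^ n := by fun_prop
  have hφm : AEStronglyMeasurable φ (volume.restrict (cell Λ z)) := hφ.1.restrict
  have e : (fun x => φ x * ‖x - cellCenter Λ z‖ ^ n)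
      = (cellAverage Λ φ z • fun x => ‖x - cellCenter Λ z‖ ^ n)
        + fun x => (φ x - cellAverage Λ φ z) * ‖x - cellCenter Λ z‖ ^ n := by
    ext x
    simp only [Pi.add_apply, Pi.smul_apply, smul_eq_mul]
    ring
  rw [e]
  refine (eLpNorm_add_le (hc.aestronglyMeasurable.const_smul _)
    ((hφm.sub aestronglyMeasurable_const).mul hc.aestronglyMeasurable) one_le_two).trans ?_
  refine add_le_add ?_ ?_
  · rw [eLpNorm_const_smul, Real.enorm_eq_ofReal_abs, ENNReal.ofReal_mul (abs_nonneg _)]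
    gcongr
    exact eLpNorm_cell_norm_sub_pow_le hΛ z n
  · refine eLpNorm_le_mul_eLpNorm_of_ae_le_mul ?_ _
    filter_upwards [ae_restrict_mem (measurableSet_cell Λ z)] with x hx
    rw [Pi.mul_apply, norm_mul, mul_comm, norm_pow, norm_norm]
    gcongr
    · exact norm_sub_cellCenter_le hΛ hx
    · exact le_rfl

theorem enorm_sub_cellAverage_sq_le (hΛ : 0 < Λ) {φ : E3 → ℝ} (hφ : MemLp φ 2 volume)
    (z : Fin 3 → ℤ) (x : E3) :
    ‖φ x - cellAverage Λ φ z‖ₑ ^ 2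
      ≤ ENNReal.ofReal ((2 / Λ) ^ 3)⁻¹ * ∫⁻ y in cell Λ z, ‖φ x - φ y‖ₑ ^ 2 := by
  have : IsFiniteMeasure (volume.restrict (cell Λ z)) :=
    isFiniteMeasure_restrict.2 (volume_cell_lt_top hΛ z).ne
  set μ := volume.restrict (cell Λ z) with hμ
  have hφ2 : MemLp φ 2 μ := hφ.mono_measure Measure.restrict_le_self
  have hD : MemLp (fun y => φ x - φ y) 2 μ := (memLp_const _).sub hφ2
  have hQ : μ.real Set.univ = (2 / Λ) ^ 3 := by
    rw [hμ, measureReal_restrict_apply_univ, volume_real_cell hΛ]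
  have hQ0 : (0 : ℝ) < (2 / Λ) ^ 3 := by positivity
  have e1 : φ x - cellAverage Λ φ z = ((2 / Λ) ^ 3)⁻¹ * ∫ y, (φ x - φ y) ∂μ := by
    rw [integral_sub (integrable_const _) (hφ2.integrable one_le_two), integral_const, hQ,
      cellAverage, smul_eq_mul, ← hμ, mul_sub,
      inv_mul_cancel_left₀ hQ0.ne']
  have h1 : ‖∫ y, (φ x - φ y) ∂μ‖ₑ ≤ eLpNorm (fun y => φ x - φ y) 1 μ := by
    rw [eLpNorm_one_eq_lintegral_enorm]
    exact enorm_integral_le_lintegral_enorm _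
  have h2 := eLpNorm_le_eLpNorm_mul_rpow_measure_univ (p := 1) (q := 2) one_le_two hD.1
  have h3 : (μ Set.univ ^ (1 / (1 : ℝ≥0∞).toReal - 1 / (2 : ℝ≥0∞).toReal)) ^ 2
      = ENNReal.ofReal ((2 / Λ) ^ 3) := by
    rw [← hQ, ofReal_measureReal, ← ENNReal.rpow_natCast, ← ENNReal.rpow_mul]
    norm_num
  have h4 : eLpNorm (fun y => φ x - φ y) 2 μ ^ 2 = ∫⁻ y, ‖φ x - φ y‖ₑ ^ 2 ∂μ := by
    rw [eLpNorm_eq_lintegral_rpow_enorm_toReal (by simp) (by simp), ← ENNReal.rpow_natCast,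
      ← ENNReal.rpow_mul]
    norm_num
  calc ‖φ x - cellAverage Λ φ z‖ₑ ^ 2
      ≤ (ENNReal.ofReal ((2 / Λ) ^ 3)⁻¹ * (eLpNorm (fun y => φ x - φ y) 2 μ *
          μ Set.univ ^ (1 / (1 : ℝ≥0∞).toReal - 1 / (2 : ℝ≥0∞).toReal))) ^ 2 := by
        rw [e1, enorm_mul, Real.enorm_eq_ofReal (by positivity)]
        gcongr
        exact h1.trans h2
    _ = (ENNReal.ofReal ((2 / Λ) ^ 3)⁻¹ ^ 2 * ENNReal.ofReal ((2 / Λ) ^ 3))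
          * ∫⁻ y, ‖φ x - φ y‖ₑ ^ 2 ∂μ := by
        rw [mul_pow, mul_pow, h3, h4]; ring
    _ = _ := by
        rw [← ENNReal.ofReal_pow (by positivity), ← ENNReal.ofReal_mul (by positivity)]
        congr 2
        field_simp

/-- Replacing the cube in `y` by a ball around `x` whose radius is the cube's diameter makes the
inner domain translation invariant, so that `y = x + v` reduces everything to translates of `φ`. -/
theorem cellOscillation_sq_le (hΛ : 0 < Λ) {φ : E3 → ℝ} (hφ : MemLp φ 2 volume)
    (z : Fin 3 → ℤ) :
    cellOscillation Λ φ z ^ 2 ≤ ENNReal.ofReal ((2 / Λ) ^ 3)⁻¹ * ∫⁻ x in cell Λ z,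
      ∫⁻ y in Metric.closedBall x (2 * √3 / Λ), ‖φ x - φ y‖ₑ ^ 2 := by
  have h4 : cellOscillation Λ φ z ^ 2
      = ∫⁻ x in cell Λ z, ‖φ x - cellAverage Λ φ z‖ₑ ^ 2 := by
    rw [cellOscillation, eLpNorm_eq_lintegral_rpow_enorm_toReal (by simp) (by simp),
      ← ENNReal.rpow_natCast, ← ENNReal.rpow_mul]
    norm_num
  rw [h4, ← lintegral_const_mul' _ _ ENNReal.ofReal_ne_top]
  refine setLIntegral_mono' (measurableSet_cell Λ z) fun x hx => ?_
  refine (enorm_sub_cellAverage_sq_le hΛ hφ z x).trans ?_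
  gcongr
  intro y hy
  rw [mem_closedBall_iff_norm]
  exact norm_sub_le_of_mem_cell hΛ hy hx

theorem lintegral_closedBall_translate_sub_le {φ : Lp ℝ 2 (volume : Measure E3)}
    {g : Lp E3 2 (volume : Measure E3)} (h : IsWeakGradient φ g) {ρ : ℝ} (hρ : 0 ≤ ρ) :
    ∫⁻ x, ∫⁻ y in Metric.closedBall x ρ, ‖φ x - φ y‖ₑ ^ 2
      ≤ ENNReal.ofReal ((ρ * ‖g‖) ^ 2) * volume (Metric.closedBall (0 : E3) ρ) := by
  have hφm : Measurable φ := (Lp.stronglyMeasurable φ).measurable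
  have e1 : ∀ x : E3, ∫⁻ y in Metric.closedBall x ρ, ‖φ x - φ y‖ₑ ^ 2
      = ∫⁻ v in Metric.closedBall (0 : E3) ρ, ‖φ (x + v) - φ x‖ₑ ^ 2 := fun x => by
    rw [← lintegral_indicator Metric.isClosed_closedBall.measurableSet,
      ← lintegral_indicator Metric.isClosed_closedBall.measurableSet,
      ← lintegral_add_left_eq_self _ x]
    refine lintegral_congr fun v => ?_
    by_cases hv : v ∈ Metric.closedBall (0 : E3) ρ
    · have hv' : x + v ∈ Metric.closedBall x ρ := by
        rw [mem_closedBall_iff_norm] at *; simpa using hv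
      rw [Set.indicator_of_mem hv, Set.indicator_of_mem hv', ← enorm_neg, neg_sub]
    · have hv' : x + v ∉ Metric.closedBall x ρ := by
        rw [mem_closedBall_iff_norm] at *; simpa using hv
      rw [Set.indicator_of_notMem hv, Set.indicator_of_notMem hv']
  simp only [e1]
  rw [lintegral_lintegral_swap (by
    have : Measurable (Function.uncurry fun (x v : E3) => ‖φ (x + v) - φ x‖ₑ ^ 2) := by
      unfold Function.uncurry
      fun_prop
    exact this.aemeasurable)]
  calc ∫⁻ v in Metric.closedBall (0 : E3) ρ, ∫⁻ x, ‖φ (x + v) - φ x‖ₑ ^ 2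
      ≤ ∫⁻ _ in Metric.closedBall (0 : E3) ρ, ENNReal.ofReal ((ρ * ‖g‖) ^ 2) := by
        refine setLIntegral_mono' Metric.isClosed_closedBall.measurableSet fun v hv => ?_
        have h4 : ∫⁻ x, ‖φ (x + v) - φ x‖ₑ ^ 2
            = eLpNorm (fun x => φ (x + v) - φ x) 2 volume ^ 2 := by
          rw [eLpNorm_eq_lintegral_rpow_enorm_toReal (by simp) (by simp),
            ← ENNReal.rpow_natCast, ← ENNReal.rpow_mul]
          norm_num
        rw [h4, ENNReal.ofReal_pow (by positivity)]
        gcongr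
        refine (eLpNorm_translate_sub_le h v).trans (ENNReal.ofReal_le_ofReal ?_)
        rw [mul_comm]
        gcongr
        simpa using hv
    _ = _ := by rw [setLIntegral_const]

theorem sum_cellOscillation_sq_le (hΛ : 0 < Λ) {φ : Lp ℝ 2 (volume : Measure E3)}
    {g : Lp E3 2 (volume : Measure E3)} (h : IsWeakGradient φ g) (J : Finset (Fin 3 → ℤ)) :
    ∑ z ∈ J, cellOscillation Λ φ z ^ 2
      ≤ ENNReal.ofReal (48 * √3 * Real.pi * (‖g‖ / Λ) ^ 2) := by
  set F : E3 → ℝ≥0∞ := fun x =>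
    ∫⁻ y in Metric.closedBall x (2 * √3 / Λ), ‖φ x - φ y‖ₑ ^ 2 with hF
  have hsum : ∑ z ∈ J, ∫⁻ x in cell Λ z, F x ≤ ∫⁻ x, F x := by
    rw [← lintegral_biUnion_finset (fun z _ z' _ hz => pairwise_disjoint_cell Λ hz)
      (fun z _ => measurableSet_cell Λ z)]
    exact setLIntegral_le_lintegral _ _
  calc ∑ z ∈ J, cellOscillation Λ φ z ^ 2
      ≤ ∑ z ∈ J, ENNReal.ofReal ((2 / Λ) ^ 3)⁻¹ * ∫⁻ x in cell Λ z, F x :=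
        Finset.sum_le_sum fun z _ => cellOscillation_sq_le hΛ (Lp.memLp φ) z
    _ = ENNReal.ofReal ((2 / Λ) ^ 3)⁻¹ * ∑ z ∈ J, ∫⁻ x in cell Λ z, F x := by
        rw [Finset.mul_sum]
    _ ≤ ENNReal.ofReal ((2 / Λ) ^ 3)⁻¹ * (ENNReal.ofReal ((2 * √3 / Λ * ‖g‖) ^ 2)
          * volume (Metric.closedBall (0 : E3) (2 * √3 / Λ))) := by
        gcongr
        exact hsum.trans (lintegral_closedBall_translate_sub_le h (by positivity))
    -- The constant is `(Λ/2)³ · 12(‖g‖/Λ)² · (4π/3)(2√3/Λ)³`.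
    _ = _ := by
        rw [EuclideanSpace.volume_closedBall_fin_three, ← ENNReal.ofReal_pow (by positivity),
          ← ENNReal.ofReal_mul (by positivity), ← ENNReal.ofReal_mul (by positivity),
          ← ENNReal.ofReal_mul (by positivity)]
        congr 1
        have h3 : √3 ^ 2 = 3 := Real.sq_sqrt (by norm_num)
        have h4 : √3 ^ 4 = 9 := by rw [show (4 : ℕ) = 2 * 2 from rfl, pow_mul, h3]; norm_num
        field_simp
        ring_nf
        rw [h4]
        ring

theorem cellOscillation_ne_top (hΛ : 0 < Λ) {φ : E3 → ℝ} (hφ : MemLp φ 2 volume)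
    (z : Fin 3 → ℤ) : cellOscillation Λ φ z ≠ ⊤ := by
  have : IsFiniteMeasure (volume.restrict (cell Λ z)) :=
    isFiniteMeasure_restrict.2 (volume_cell_lt_top hΛ z).ne
  exact ((hφ.mono_measure Measure.restrict_le_self).sub (memLp_const _)).eLpNorm_ne_top

theorem sum_toReal_cellOscillation_le (hΛ : 0 < Λ) {φ : Lp ℝ 2 (volume : Measure E3)}
    {g : Lp E3 2 (volume : Measure E3)} (h : IsWeakGradient φ g) (J : Finset (Fin 3 → ℤ)) :
    ∑ z ∈ J, (cellOscillation Λ φ z).toReal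
      ≤ √J.card * √(48 * √3 * Real.pi) * (‖g‖ / Λ) := by
  have h1 : ∑ z ∈ J, (cellOscillation Λ φ z).toReal ^ 2 ≤ 48 * √3 * Real.pi * (‖g‖ / Λ) ^ 2 := by
    have h2 := ENNReal.toReal_mono ENNReal.ofReal_ne_top (sum_cellOscillation_sq_le hΛ h J)
    rw [ENNReal.toReal_ofReal (by positivity), ENNReal.toReal_sum fun z _ =>
      ENNReal.pow_ne_top (cellOscillation_ne_top hΛ (Lp.memLp φ) z)] at h2
    simpa only [ENNReal.toReal_pow] using h2
  have h3 := Real.sum_mul_le_sqrt_mul_sqrt J (fun _ => (1 : ℝ))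
    fun z => (cellOscillation Λ φ z).toReal
  simp only [one_mul, one_pow, Finset.sum_const, nsmul_eq_mul, mul_one] at h3
  refine h3.trans ?_
  rw [mul_assoc]
  gcongr
  calc √(∑ z ∈ J, (cellOscillation Λ φ z).toReal ^ 2)
      ≤ √(48 * √3 * Real.pi * (‖g‖ / Λ) ^ 2) := Real.sqrt_le_sqrt h1
    _ = _ := by rw [Real.sqrt_mul (by positivity), Real.sqrt_sq (by positivity)]

theorem sum_setIntegral_cell_abs_le {φ : E3 → ℝ} (hφ : Integrable φ volume)
    (J : Finset (Fin 3 → ℤ)) :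
    ∑ z ∈ J, ∫ x in cell Λ z, |φ x| ≤ ∫ x, |φ x| := by
  rw [← integral_biUnion_finset J (fun z _ => measurableSet_cell Λ z)
    (fun z _ z' _ hz => pairwise_disjoint_cell Λ hz) fun z _ => hφ.abs.integrableOn]
  exact setIntegral_le_integral hφ.abs (Eventually.of_forall fun x => abs_nonneg _)

end Oscillation

/-! ### Expansion of plane waves -/

section PlaneWave

variable {X E : Type*} [MeasurableSpace X] {μ : Measure X} [NormedAddCommGroup E]

theorem toReal_eLpNorm_two_sq {f : X → E} (hf : MemLp f 2 μ) :
    (eLpNorm f 2 μ).toReal ^ 2 = ∫ x, ‖f x‖ ^ 2 ∂μ := by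
  rw [hf.eLpNorm_eq_integral_rpow_norm (by simp) (by simp), ENNReal.toReal_ofReal (by positivity)]
  simp only [ENNReal.toReal_ofNat, Real.rpow_ofNat]
  rw [← one_div, ← Real.sqrt_eq_rpow,
    Real.sq_sqrt (integral_nonneg fun x => by positivity)]

theorem sum_norm_toLp_sq_le {ι : Type*} [Fintype ι] {F : ι → X → E}
    (hF : ∀ i, MemLp (F i) 2 μ) {G : X → ℝ} (hG : MemLp G 2 μ)
    (h : ∀ᵐ x ∂μ, ∑ i, ‖F i x‖ ^ 2 ≤ G x ^ 2) :
    ∑ i, ‖(hF i).toLp‖ ^ 2 ≤ (eLpNorm G 2 μ).toReal ^ 2 := by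
  have hint : ∀ i, Integrable (fun x => ‖F i x‖ ^ 2) μ := fun i =>
    (memLp_two_iff_integrable_sq_norm (hF i).1).1 (hF i)
  simp only [Lp.norm_toLp, toReal_eLpNorm_two_sq (hF _), toReal_eLpNorm_two_sq hG]
  rw [← integral_finsetSum _ fun i _ => hint i]
  refine integral_mono_ae (integrable_finsetSum _ fun i _ => hint i)
    ((memLp_two_iff_integrable_sq_norm hG.1).1 hG) ?_
  filter_upwards [h] with x hx
  simpa using hx

theorem coeFn_finsetSum_ae {ι : Type*} (s : Finset ι) {p : ℝ≥0∞} {f : ι → Lp E p μ}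
    {F : ι → X → E} (h : ∀ i ∈ s, f i =ᵐ[μ] F i) :
    ((∑ i ∈ s, f i : Lp E p μ) : X → E) =ᵐ[μ] fun x => ∑ i ∈ s, F i x := by
  classical
  induction s using Finset.induction_on with
  | empty =>
    simp only [Finset.sum_empty]
    exact Lp.coeFn_zero E p μ
  | insert a s ha ih =>
    rw [Finset.sum_insert ha]
    filter_upwards [Lp.coeFn_add (f a) (∑ i ∈ s, f i), h a (Finset.mem_insert_self _ _),
      ih fun i hi => h i (Finset.mem_insert_of_mem hi)] with x h1 h2 h3
    rw [h1, Pi.add_apply, h2, h3, Finset.sum_insert ha]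

/-- Monomials are indexed by ordered tuples rather than exponents. No multinomial coefficients
occur, and Cauchy-Schwarz over the index loses no combinatorial factor in `n`. -/
theorem sum_prod_coord_sq (y : E3) (n : ℕ) :
    ∑ a : Fin n → Fin 3, (∏ i, y (a i)) ^ 2 = (‖y‖ ^ n) ^ 2 := by
  rw [← pow_mul, mul_comm n, pow_mul, EuclideanSpace.norm_sq_eq, Fintype.sum_pow]
  simp [Finset.prod_pow]

theorem sum_prod_coord_mul (k y : E3) (n : ℕ) :
    ∑ a : Fin n → Fin 3, (∏ i, y (a i)) * ∏ i, k (a i) = ⟪k, y⟫_ℝ ^ n := by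
  have e : ⟪k, y⟫_ℝ = ∑ j, y j * k j := by
    simp [PiLp.inner_apply]
  rw [e, Fintype.sum_pow]
  simp [Finset.prod_mul_distrib]

/-- The remainder of the exponential series. -/
noncomputable def expRemainder (M : ℕ) (t : ℝ) : ℝ :=
  Real.exp t - ∑ m ∈ Finset.range M, t ^ m / m.factorial

theorem expRemainder_mono (M : ℕ) {s t : ℝ} (hs : 0 ≤ s) (hst : s ≤ t) :
    expRemainder M s ≤ expRemainder M t := by
  have key : ∀ r : ℝ, HasSum (fun m => r ^ (m + M) / (m + M).factorial) (expRemainder M r) :=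
    fun r => by
      have h := (hasSum_nat_add_iff' (f := fun m : ℕ => r ^ m / (m.factorial : ℝ)) M).2
        (by simpa [Real.exp_eq_exp_ℝ] using NormedSpace.expSeries_div_hasSum_exp r)
      rw [expRemainder, Real.exp_eq_exp_ℝ]
      exact h
  refine hasSum_le (fun m => ?_) (key s) (key t)
  gcongr

theorem tendsto_expRemainder (t : ℝ) : Tendsto (fun M => expRemainder M t) atTop (𝓝 0) := by
  have h : HasSum (fun m : ℕ => t ^ m / (m.factorial : ℝ)) (Real.exp t) := by
    simpa [Real.exp_eq_exp_ℝ] using NormedSpace.expSeries_div_hasSum_exp t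
  simpa [expRemainder] using h.tendsto_sum_nat.const_sub (Real.exp t)

/-- The coefficient functions in the expansion of the plane wave `(2π)^{-3/2} e^{i k·x}` around
`c` in monomials of `x - c`. -/
noncomputable def planeWaveCoeff (c : E3) (n : ℕ) (a : Fin n → Fin 3) (k : E3) : ℂ :=
  (((2 * Real.pi) ^ (-(3 / 2) : ℝ) : ℝ) : ℂ) * (Complex.I ^ n / (n.factorial : ℂ))
    * Complex.exp (Complex.I * ((⟪k, c⟫_ℝ : ℝ) : ℂ)) * ((∏ i, k (a i) : ℝ) : ℂ)

theorem continuous_planeWaveCoeff (c : E3) (n : ℕ) (a : Fin n → Fin 3) :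
    Continuous (planeWaveCoeff c n a) := by
  unfold planeWaveCoeff
  fun_prop

theorem norm_planeWaveCoeff (c : E3) (n : ℕ) (a : Fin n → Fin 3) (k : E3) :
    ‖planeWaveCoeff c n a k‖
      = (2 * Real.pi) ^ (-(3 / 2) : ℝ) / n.factorial * |∏ i, k (a i)| := by
  unfold planeWaveCoeff
  rw [norm_mul, norm_mul, norm_mul, norm_cexp, Complex.norm_real, Complex.norm_real, norm_div,
    norm_pow, Complex.norm_I, Complex.norm_natCast, Real.norm_of_nonneg (by positivity),
    Real.norm_eq_abs]
  ring

theorem sum_norm_planeWaveCoeff_sq (c : E3) (n : ℕ) (k : E3) :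
    ∑ a : Fin n → Fin 3, ‖planeWaveCoeff c n a k‖ ^ 2
      = ((2 * Real.pi) ^ (-(3 / 2) : ℝ) / n.factorial * ‖k‖ ^ n) ^ 2 := by
  simp only [norm_planeWaveCoeff, mul_pow, sq_abs]
  rw [← Finset.mul_sum, sum_prod_coord_sq]

theorem sum_mul_planeWaveCoeff (c y k : E3) (n : ℕ) :
    ∑ a : Fin n → Fin 3, ((∏ i, y (a i) : ℝ) : ℂ) * planeWaveCoeff c n a k
      = (((2 * Real.pi) ^ (-(3 / 2) : ℝ) : ℝ) : ℂ)
        * (Complex.exp (Complex.I * ((⟪k, c⟫_ℝ : ℝ) : ℂ))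
          * ((Complex.I * ((⟪k, y⟫_ℝ : ℝ) : ℂ)) ^ n / (n.factorial : ℂ))) := by
  rw [mul_pow, ← Complex.ofReal_pow, ← sum_prod_coord_mul]
  push_cast
  simp only [Finset.mul_sum, Finset.sum_div]
  refine Finset.sum_congr rfl fun a _ => ?_
  unfold planeWaveCoeff
  push_cast
  ring

theorem norm_planeWave_sub_le (c y k : E3) (M : ℕ) {t : ℝ} (ht : ‖k‖ * ‖y‖ ≤ t) :
    ‖(((2 * Real.pi) ^ (-(3 / 2) : ℝ) : ℝ) : ℂ)
        * Complex.exp (Complex.I * ((⟪k, c + y⟫_ℝ : ℝ) : ℂ))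
      - ∑ n ∈ Finset.range M,
        ∑ a : Fin n → Fin 3, ((∏ i, y (a i) : ℝ) : ℂ) * planeWaveCoeff c n a k‖
      ≤ (2 * Real.pi) ^ (-(3 / 2) : ℝ) * expRemainder M t := by
  simp only [sum_mul_planeWaveCoeff]
  rw [inner_add_right, Complex.ofReal_add, mul_add, Complex.exp_add, ← Finset.mul_sum,
    ← Finset.mul_sum, ← mul_sub, ← mul_sub, norm_mul, norm_mul, norm_cexp, one_mul,
    Complex.norm_real, Real.norm_of_nonneg (by positivity)]
  gcongr
  refine (Complex.norm_exp_sub_sum_le_exp_norm_sub_sum _ M).trans ?_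
  refine expRemainder_mono M (norm_nonneg _) (le_trans ?_ ht)
  rw [norm_mul, Complex.norm_I, one_mul, Complex.norm_real]
  exact norm_inner_le_norm k y

end PlaneWave

/-! ### Moment functionals on the one-photon space -/

section Moments

variable {σ Λ : ℝ}

theorem memLp_shell_of_continuous {E : Type*} [NormedAddCommGroup E] {w : E3 → E}
    (hw : Continuous w) (σ Λ : ℝ) : MemLp w 2 (shellMeasure σ Λ) := by
  obtain ⟨C, hC⟩ := (isCompact_closedBall (0 : E3) Λ).exists_bound_of_continuousOn
    hw.continuousOn
  refine MemLp.of_bound hw.aestronglyMeasurable C ?_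
  filter_upwards [ae_norm_le σ Λ] with k hk
  exact hC k (mem_closedBall_zero_iff.2 hk)

theorem memLp_conj_smul_single {w : E3 → ℂ} (hw : Continuous w) (σ Λ : ℝ) (j : Fin 3) :
    MemLp (fun k => (starRingEnd ℂ) (w k) • (EuclideanSpace.single j 1 : V3)) 2
      (shellMeasure σ Λ) :=
  memLp_shell_of_continuous (by fun_prop) σ Λ

/-- The functional `f ↦ ∫ w(k) f_j(k) dk`. -/
noncomputable def momentFunctional (σ Λ : ℝ) {w : E3 → ℂ} (hw : Continuous w) (j : Fin 3) :
    Photon σ Λ →L[ℂ] ℂ :=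
  (innerSL ℂ ((memLp_conj_smul_single hw σ Λ j).toLp _)) ∘L (photonSubmodule σ Λ).subtypeL

theorem norm_momentFunctional_le {w : E3 → ℂ} (hw : Continuous w) (j : Fin 3) :
    ‖momentFunctional σ Λ hw j‖ ≤ ‖(memLp_conj_smul_single hw σ Λ j).toLp _‖ := by
  refine (ContinuousLinearMap.opNorm_comp_le _ _).trans ?_
  rw [innerSL_apply_norm]
  exact mul_le_of_le_one_right (norm_nonneg _) (Submodule.norm_subtypeL_le _)

theorem integrable_smul_photon {w : E3 → ℂ} (hw : Continuous w) (f : Photon σ Λ) :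
    Integrable (fun k => w k • f.1 k) (shellMeasure σ Λ) :=
  memLp_one_iff_integrable.1 ((Lp.memLp f.1).smul (memLp_shell_of_continuous hw σ Λ))

theorem momentFunctional_apply {w : E3 → ℂ} (hw : Continuous w) (j : Fin 3) (f : Photon σ Λ) :
    momentFunctional σ Λ hw j f = (∫ k, w k • f.1 k ∂shellMeasure σ Λ) j := by
  have h1 : (∫ k, w k • f.1 k ∂shellMeasure σ Λ) j
      = ∫ k, (w k • f.1 k : V3) j ∂shellMeasure σ Λ :=
    ((EuclideanSpace.proj j : V3 →L[ℂ] ℂ).integral_comp_comm (integrable_smul_photon hw f)).symm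
  rw [h1]
  change ⟪(memLp_conj_smul_single hw σ Λ j).toLp _, f.1⟫_ℂ = _
  rw [L2.inner_def]
  refine integral_congr_ae ?_
  filter_upwards [(memLp_conj_smul_single hw σ Λ j).coeFn_toLp] with k hk
  rw [hk, inner_smul_left, EuclideanSpace.inner_single_left]
  simp

theorem sum_momentFunctional_smul_single {w : E3 → ℂ} (hw : Continuous w) (f : Photon σ Λ) :
    ∑ j, momentFunctional σ Λ hw j f • (EuclideanSpace.single j 1 : V3)
      = ∫ k, w k • f.1 k ∂shellMeasure σ Λ := by
  simp only [momentFunctional_apply]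
  ext i
  simp [Pi.single_apply]

theorem toReal_volume_shell_le (hΛ : 0 ≤ Λ) (σ : ℝ) :
    (shellMeasure σ Λ).real Set.univ ≤ 4 / 3 * Real.pi * Λ ^ 3 := by
  rw [measureReal_restrict_apply_univ]
  have h : volume.real (shell σ Λ) ≤ volume.real (Metric.ball (0 : E3) Λ) :=
    measureReal_mono (fun _ hk => mem_ball_zero_iff.2 hk.2) measure_ball_lt_top.ne
  refine h.trans (le_of_eq ?_)
  rw [Measure.real, EuclideanSpace.volume_ball_fin_three, ENNReal.toReal_mul,
    ENNReal.toReal_pow, ENNReal.toReal_ofReal hΛ, ENNReal.toReal_ofReal (by positivity)]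
  ring

/-- The squares of the coefficient functions sum pointwise to `((2π)^{-3/2}|k|ⁿ/n!)²`; then `|k| ≤
Λ` and the volume of the full ball bound the integral. Restriction to transverse fields can only
decrease the norms. -/
theorem sum_norm_momentFunctional_sq_le (hΛ : 0 ≤ Λ) (σ : ℝ) (c : E3) (n : ℕ) (j : Fin 3) :
    ∑ a : Fin n → Fin 3, ‖momentFunctional σ Λ (continuous_planeWaveCoeff c n a) j‖ ^ 2
      ≤ ((2 * Real.pi) ^ (-(3 / 2) : ℝ) / n.factorial * Λ ^ n * √(4 / 3 * Real.pi * Λ ^ 3)) ^ 2 := by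
  set B : ℝ := (2 * Real.pi) ^ (-(3 / 2) : ℝ) / n.factorial * Λ ^ n with hB
  have hB0 : 0 ≤ B := by positivity
  calc ∑ a : Fin n → Fin 3, ‖momentFunctional σ Λ (continuous_planeWaveCoeff c n a) j‖ ^ 2
      ≤ ∑ a : Fin n → Fin 3,
        ‖(memLp_conj_smul_single (continuous_planeWaveCoeff c n a) σ Λ j).toLp _‖ ^ 2 := by
        gcongr
        exact norm_momentFunctional_le _ _
    _ ≤ (eLpNorm (fun _ : E3 => B) 2 (shellMeasure σ Λ)).toReal ^ 2 := by
        refine sum_norm_toLp_sq_le _ (memLp_const _) ?_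
        filter_upwards [ae_norm_le σ Λ] with k hk
        simp only [norm_smul, RCLike.norm_conj, PiLp.norm_single, norm_one, mul_one]
        rw [sum_norm_planeWaveCoeff_sq, hB]
        gcongr
    _ = B ^ 2 * (shellMeasure σ Λ).real Set.univ := by
        rw [toReal_eLpNorm_two_sq (memLp_const _), integral_const, smul_eq_mul, Real.norm_of_nonneg hB0]
        ring
    _ ≤ B ^ 2 * (4 / 3 * Real.pi * Λ ^ 3) := by
        gcongr
        exact toReal_volume_shell_le hΛ σ
    _ = _ := by rw [mul_pow B, Real.sq_sqrt (by positivity)]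

end Moments

/-! ### The trace norm of `Φ` -/

section PhiTraceNorm

variable {α σ Λ : ℝ}

/-- The scalar factor `√α φ(x) ∏ᵢ (x - c)_{aᵢ}` on a cube with centre `c`. -/
noncomputable def cellMonomial (α Λ : ℝ) (φ : E3 → ℝ) (z : Fin 3 → ℤ) {n : ℕ}
    (a : Fin n → Fin 3) : E3 → ℝ :=
  (cell Λ z).indicator fun x => √α * φ x * ∏ i, (x - cellCenter Λ z) (a i)

theorem memLp_cell_mul {φ : E3 → ℝ} (hφ : MemLp φ 2 volume) (hΛ : 0 < Λ) (z : Fin 3 → ℤ)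
    {f : E3 → ℝ} (hf : Continuous f) :
    MemLp ((cell Λ z).indicator fun x => √α * φ x * f x) 2 volume := by
  rw [memLp_indicator_iff_restrict (measurableSet_cell Λ z)]
  have h1 : MemLp (fun x => √α * φ x) 2 (volume.restrict (cell Λ z)) :=
    (hφ.const_mul _).mono_measure Measure.restrict_le_self
  have h2 : MemLp f ⊤ (volume.restrict (cell Λ z)) := memLp_cell_of_continuous hf hΛ z ⊤
  exact h2.mul h1

theorem memLp_cellMonomial {φ : E3 → ℝ} (hφ : MemLp φ 2 volume) (hΛ : 0 < Λ) (z : Fin 3 → ℤ)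
    {n : ℕ} (a : Fin n → Fin 3) : MemLp (cellMonomial α Λ φ z a) 2 volume :=
  memLp_cell_mul hφ hΛ z (by fun_prop)

theorem memLp_cellMonomial_smul_single {φ : E3 → ℝ} (hφ : MemLp φ 2 volume) (hΛ : 0 < Λ)
    (z : Fin 3 → ℤ) {n : ℕ} (a : Fin n → Fin 3) (j : Fin 3) :
    MemLp (fun x => ((cellMonomial α Λ φ z a x : ℝ) : ℂ) • (EuclideanSpace.single j 1 : V3)) 2
      volume := by
  have h := memLp_cellMonomial (α := α) hφ hΛ z a
  refine MemLp.of_le_mul (c := 1) h ?_ (Eventually.of_forall fun x => ?_)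
  · exact (Complex.continuous_ofReal.comp_aestronglyMeasurable h.1).smul
      aestronglyMeasurable_const
  · simp [norm_smul]

/-- The vectors in the rank one expansion of `Φ`. -/
noncomputable def cellVector {φ : E3 → ℝ} (hφ : MemLp φ 2 volume) (hΛ : 0 < Λ) (α : ℝ)
    (z : Fin 3 → ℤ) {n : ℕ} (a : Fin n → Fin 3) (j : Fin 3) : Lp V3 2 (volume : Measure E3) :=
  (memLp_cellMonomial_smul_single (α := α) hφ hΛ z a j).toLp _

theorem sum_norm_cellVector_sq_le {φ : E3 → ℝ} (hφ : MemLp φ 2 volume) (hΛ : 0 < Λ)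
    (z : Fin 3 → ℤ) (n : ℕ) (j : Fin 3) :
    ∑ a : Fin n → Fin 3, ‖cellVector hφ hΛ α z a j‖ ^ 2
      ≤ (√α * (eLpNorm (fun x => φ x * ‖x - cellCenter Λ z‖ ^ n) 2
          (volume.restrict (cell Λ z))).toReal) ^ 2 := by
  have hG : MemLp ((cell Λ z).indicator fun x => √α * φ x * ‖x - cellCenter Λ z‖ ^ n) 2 volume :=
    memLp_cell_mul hφ hΛ z (by fun_prop)
  have hnorm : (eLpNorm ((cell Λ z).indicator fun x => √α * φ x * ‖x - cellCenter Λ z‖ ^ n) 2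
      volume).toReal = √α * (eLpNorm (fun x => φ x * ‖x - cellCenter Λ z‖ ^ n) 2
          (volume.restrict (cell Λ z))).toReal := by
    rw [eLpNorm_indicator_eq_eLpNorm_restrict (measurableSet_cell Λ z)]
    have e : (fun x => √α * φ x * ‖x - cellCenter Λ z‖ ^ n)
        = √α • fun x => φ x * ‖x - cellCenter Λ z‖ ^ n := by
      ext x; simp only [Pi.smul_apply, smul_eq_mul]; ring
    rw [e, eLpNorm_const_smul, ENNReal.toReal_mul]
    simp
  rw [← hnorm]
  refine sum_norm_toLp_sq_le _ hG (Eventually.of_forall fun x => ?_)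
  simp only [norm_smul, Complex.norm_real, PiLp.norm_single, norm_one, mul_one, Real.norm_eq_abs,
    sq_abs, cellMonomial]
  by_cases hx : x ∈ cell Λ z
  · simp only [Set.indicator_of_mem hx, mul_pow _ _ 2]
    rw [← Finset.mul_sum, sum_prod_coord_sq]
  · simp [Set.indicator_of_notMem hx]

/-- The part of `Φ` belonging to a cube and to the terms of order `n` in the expansion of the plane
wave. -/
noncomputable def cellOperator {φ : E3 → ℝ} (hφ : MemLp φ 2 volume) (hΛ : 0 < Λ) (α σ : ℝ)
    (z : Fin 3 → ℤ) (n : ℕ) : Photon σ Λ →L[ℂ] Lp V3 2 (volume : Measure E3) :=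
  ∑ j : Fin 3, ∑ a : Fin n → Fin 3,
    (momentFunctional σ Λ (continuous_planeWaveCoeff (cellCenter Λ z) n a) j).smulRight
      (cellVector hφ hΛ α z a j)

/-- Sum the rank one bounds: Cauchy-Schwarz over the tuples `a` separates the `k` norms from the `x`
norms, and the three vector components give the factor 3. -/
theorem traceNormLE_cellOperator {φ : E3 → ℝ} (hφ : MemLp φ 2 volume) (hΛ : 0 < Λ)
    (z : Fin 3 → ℤ) (n : ℕ) :
    TraceNormLE (cellOperator hφ hΛ α σ z n)
      (3 * ((2 * Real.pi) ^ (-(3 / 2) : ℝ) / n.factorial * Λ ^ n * √(4 / 3 * Real.pi * Λ ^ 3)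
        * (√α * (eLpNorm (fun x => φ x * ‖x - cellCenter Λ z‖ ^ n) 2
          (volume.restrict (cell Λ z))).toReal))) := by
  have h := TraceNormLE.sum Finset.univ fun j (_ : j ∈ (Finset.univ : Finset (Fin 3))) =>
    TraceNormLE.sum Finset.univ fun a (_ : a ∈ (Finset.univ : Finset (Fin n → Fin 3))) =>
      TraceNormLE.smulRight
        (momentFunctional σ Λ (continuous_planeWaveCoeff (cellCenter Λ z) n a) j)
        (cellVector hφ hΛ α z a j)
  refine h.mono ?_
  have hj : ∀ j ∈ (Finset.univ : Finset (Fin 3)), ∑ a : Fin n → Fin 3,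
      ‖momentFunctional σ Λ (continuous_planeWaveCoeff (cellCenter Λ z) n a) j‖
        * ‖cellVector hφ hΛ α z a j‖
      ≤ (2 * Real.pi) ^ (-(3 / 2) : ℝ) / n.factorial * Λ ^ n * √(4 / 3 * Real.pi * Λ ^ 3)
        * (√α * (eLpNorm (fun x => φ x * ‖x - cellCenter Λ z‖ ^ n) 2
          (volume.restrict (cell Λ z))).toReal) := fun j _ => by
    refine (Real.sum_mul_le_sqrt_mul_sqrt _ _ _).trans ?_
    gcongr
    · exact Real.sqrt_le_iff.2 ⟨by positivity, sum_norm_momentFunctional_sq_le hΛ.le σ _ n j⟩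
    · exact Real.sqrt_le_iff.2 ⟨by positivity, sum_norm_cellVector_sq_le hφ hΛ z n j⟩
  refine (Finset.sum_le_card_nsmul _ _ _ hj).trans (le_of_eq ?_)
  simp

theorem cellOperator_apply_ae {φ : E3 → ℝ} (hφ : MemLp φ 2 volume) (hΛ : 0 < Λ)
    (z : Fin 3 → ℤ) (n : ℕ) (f : Photon σ Λ) :
    cellOperator hφ hΛ α σ z n f =ᵐ[volume] (cell Λ z).indicator fun x =>
      ((√α * φ x : ℝ) : ℂ) • ∑ a : Fin n → Fin 3,
        ((∏ i, (x - cellCenter Λ z) (a i) : ℝ) : ℂ) •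
          ∫ k, planeWaveCoeff (cellCenter Λ z) n a k • f.1 k ∂shellMeasure σ Λ := by
  have h1 : cellOperator hφ hΛ α σ z n f = ∑ j : Fin 3, ∑ a : Fin n → Fin 3,
      momentFunctional σ Λ (continuous_planeWaveCoeff (cellCenter Λ z) n a) j f •
        cellVector hφ hΛ α z a j := by
    simp only [cellOperator, sum_apply, ContinuousLinearMap.smulRight_apply]
  have h2 : ∀ (j : Fin 3) (a : Fin n → Fin 3),
      ((momentFunctional σ Λ (continuous_planeWaveCoeff (cellCenter Λ z) n a) j f •
        cellVector hφ hΛ α z a j : Lp V3 2 (volume : Measure E3)) : E3 → V3) =ᵐ[volume]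
      fun x => momentFunctional σ Λ (continuous_planeWaveCoeff (cellCenter Λ z) n a) j f •
        ((cellMonomial α Λ φ z a x : ℝ) : ℂ) • (EuclideanSpace.single j 1 : V3) := fun j a => by
    filter_upwards [Lp.coeFn_smul (momentFunctional σ Λ
      (continuous_planeWaveCoeff (cellCenter Λ z) n a) j f) (cellVector hφ hΛ α z a j),
      (memLp_cellMonomial_smul_single (α := α) hφ hΛ z a j).coeFn_toLp] with x h3 h4
    rw [h3, Pi.smul_apply, cellVector, h4]
  rw [h1]
  filter_upwards [coeFn_finsetSum_ae Finset.univ fun j _ =>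
    coeFn_finsetSum_ae Finset.univ fun a _ => h2 j a] with x hx
  rw [hx, Finset.sum_comm]
  by_cases hxz : x ∈ cell Λ z
  · simp only [Set.indicator_of_mem hxz, cellMonomial, Finset.smul_sum]
    refine Finset.sum_congr rfl fun a _ => ?_
    rw [← sum_momentFunctional_smul_single (continuous_planeWaveCoeff (cellCenter Λ z) n a) f,
      Finset.smul_sum, Finset.smul_sum]
    refine Finset.sum_congr rfl fun j _ => ?_
    rw [smul_smul, smul_smul, smul_smul]
    congr 1
    push_cast
    ring
  · simp [Set.indicator_of_notMem hxz, cellMonomial]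

/-- The partial sums of the expansion of `Φ`. -/
noncomputable def cellPartialSum {φ : E3 → ℝ} (hφ : MemLp φ 2 volume) (hΛ : 0 < Λ) (α σ : ℝ)
    (J : Finset (Fin 3 → ℤ)) (M : ℕ) : Photon σ Λ →L[ℂ] Lp V3 2 (volume : Measure E3) :=
  ∑ z ∈ J, ∑ n ∈ Finset.range M, cellOperator hφ hΛ α σ z n

/-- The side length `2/Λ` makes `|k||x - c| ≤ √3`, so the Taylor remainder is uniform in the cube
and in its position. -/
theorem norm_invFourier_sub_le (hΛ : 0 < Λ) {z : Fin 3 → ℤ} {x : E3} (hx : x ∈ cell Λ z)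
    (f : Photon σ Λ) (M : ℕ) :
    ‖invFourier σ Λ f x - ∑ n ∈ Finset.range M, ∑ a : Fin n → Fin 3,
        ((∏ i, (x - cellCenter Λ z) (a i) : ℝ) : ℂ) •
          ∫ k, planeWaveCoeff (cellCenter Λ z) n a k • f.1 k ∂shellMeasure σ Λ‖
      ≤ (2 * Real.pi) ^ (-(3 / 2) : ℝ) * expRemainder M √3
          * ∫ k, ‖f.1 k‖ ∂shellMeasure σ Λ := by
  set c := cellCenter Λ z with hc
  set y := x - c with hy
  have hint : ∀ n (a : Fin n → Fin 3), Integrable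
      (fun k => (((∏ i, y (a i) : ℝ) : ℂ) * planeWaveCoeff c n a k) • f.1 k)
      (shellMeasure σ Λ) := fun n a =>
    integrable_smul_photon ((continuous_planeWaveCoeff c n a).const_mul _) f
  have hint0 : Integrable (fun k => ((((2 * Real.pi) ^ (-(3 / 2) : ℝ) : ℝ) : ℂ)
      * Complex.exp (Complex.I * ((⟪k, c + y⟫_ℝ : ℝ) : ℂ))) • f.1 k) (shellMeasure σ Λ) :=
    integrable_smul_photon (by fun_prop) f
  have e1 : invFourier σ Λ f x = ∫ k, ((((2 * Real.pi) ^ (-(3 / 2) : ℝ) : ℝ) : ℂ)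
      * Complex.exp (Complex.I * ((⟪k, c + y⟫_ℝ : ℝ) : ℂ))) • f.1 k ∂shellMeasure σ Λ := by
    have hxy : c + y = x := by rw [hy]; abel
    simp only [invFourier, hxy, mul_smul]
    rw [integral_smul]
  have e2 : ∑ n ∈ Finset.range M, ∑ a : Fin n → Fin 3, ((∏ i, y (a i) : ℝ) : ℂ) •
        ∫ k, planeWaveCoeff c n a k • f.1 k ∂shellMeasure σ Λ
      = ∫ k, ∑ n ∈ Finset.range M, ∑ a : Fin n → Fin 3,
        (((∏ i, y (a i) : ℝ) : ℂ) * planeWaveCoeff c n a k) • f.1 k ∂shellMeasure σ Λ := by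
    rw [integral_finsetSum _ fun n _ => integrable_finsetSum _ fun a _ => hint n a]
    refine Finset.sum_congr rfl fun n _ => ?_
    rw [integral_finsetSum _ fun a _ => hint n a]
    refine Finset.sum_congr rfl fun a _ => ?_
    simp only [mul_smul]
    rw [integral_smul]
  rw [e1, e2, ← integral_sub hint0
    (integrable_finsetSum _ fun n _ => integrable_finsetSum _ fun a _ => hint n a),
    ← integral_const_mul]
  refine norm_integral_le_of_norm_le ((integrable_photon σ Λ f).norm.const_mul _) ?_
  filter_upwards [ae_norm_le σ Λ] with k hk
  simp only [← Finset.sum_smul]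
  rw [← sub_smul, norm_smul]
  gcongr
  refine norm_planeWave_sub_le c y k M ?_
  calc ‖k‖ * ‖y‖ ≤ Λ * (√3 / Λ) := by
        gcongr
        exact norm_sub_cellCenter_le hΛ hx
    _ = √3 := by field_simp

theorem cellPartialSum_apply_ae {φ : E3 → ℝ} (hφ : MemLp φ 2 volume) (hΛ : 0 < Λ)
    {J : Finset (Fin 3 → ℤ)} (hJ : ∀ᵐ x, ∀ z ∉ J, x ∈ cell Λ z → φ x = 0) (M : ℕ)
    (f : Photon σ Λ) :
    ∀ᵐ x, ∀ z, x ∈ cell Λ z → cellPartialSum hφ hΛ α σ J M f x =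
      ((√α * φ x : ℝ) : ℂ) • ∑ n ∈ Finset.range M, ∑ a : Fin n → Fin 3,
        ((∏ i, (x - cellCenter Λ z) (a i) : ℝ) : ℂ) •
          ∫ k, planeWaveCoeff (cellCenter Λ z) n a k • f.1 k ∂shellMeasure σ Λ := by
  have h1 : cellPartialSum hφ hΛ α σ J M f
      = ∑ z ∈ J, ∑ n ∈ Finset.range M, cellOperator hφ hΛ α σ z n f := by
    simp only [cellPartialSum, sum_apply]
  rw [h1]
  filter_upwards [hJ, coeFn_finsetSum_ae J fun z _ => coeFn_finsetSum_ae (Finset.range M) fun n _ =>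
    cellOperator_apply_ae (α := α) hφ hΛ z n f] with x hJx hx z hxz
  rw [hx, Finset.sum_eq_single z]
  · simp only [Set.indicator_of_mem hxz, Finset.smul_sum]
  · intro z' _ hne
    refine Finset.sum_eq_zero fun n _ => ?_
    exact Set.indicator_of_notMem
      (fun h => (Set.disjoint_left.1 (pairwise_disjoint_cell Λ hne)) h hxz) _
  · intro hz
    refine Finset.sum_eq_zero fun n _ => ?_
    rw [Set.indicator_of_mem hxz, hJx z hz hxz]
    simp

theorem tendsto_cellPartialSum (hΛ : 0 < Λ) (φ : Lp ℝ 2 (volume : Measure E3))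
    {J : Finset (Fin 3 → ℤ)} (hJ : ∀ᵐ x, ∀ z ∉ J, x ∈ cell Λ z → φ x = 0) (f : Photon σ Λ) :
    Tendsto (fun M => cellPartialSum (Lp.memLp φ) hΛ α σ J M f) atTop (𝓝 (Phi α σ Λ φ f)) := by
  set A : ℝ := ∫ k, ‖f.1 k‖ ∂shellMeasure σ Λ with hA
  rw [tendsto_iff_norm_sub_tendsto_zero]
  have hlim : Tendsto (fun M => √α * ((2 * Real.pi) ^ (-(3 / 2) : ℝ) * expRemainder M √3 * A)
      * ‖φ‖) atTop (𝓝 0) := by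
    have := (((tendsto_expRemainder √3).const_mul ((2 * Real.pi) ^ (-(3 / 2) : ℝ))).mul_const
      A).const_mul √α |>.mul_const ‖φ‖
    simpa using this
  refine squeeze_zero (fun M => norm_nonneg _) (fun M => ?_) hlim
  rw [norm_sub_rev]
  refine Lp.norm_le_mul_norm_of_ae_le_mul ?_
  filter_upwards [cellPartialSum_apply_ae (α := α) (Lp.memLp φ) hΛ hJ M f,
    (memLp_phi α σ Λ φ f).coeFn_toLp,
    Lp.coeFn_sub (Phi α σ Λ φ f) (cellPartialSum (Lp.memLp φ) hΛ α σ J M f)] with x h2 h3 h4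
  have h5 : Phi α σ Λ φ f x = ((√α * φ x : ℝ) : ℂ) • invFourier σ Λ f x := h3
  rw [h4, Pi.sub_apply, h5, h2 (fun i => ⌊x i * (Λ / 2)⌋) (fun i => rfl), ← smul_sub, norm_smul,
    Complex.norm_real, norm_mul, Real.norm_of_nonneg (Real.sqrt_nonneg α)]
  have h6 := norm_invFourier_sub_le hΛ (z := fun i => ⌊x i * (Λ / 2)⌋) (x := x) (fun i => rfl) f M
  calc _ ≤ √α * ‖φ x‖ * ((2 * Real.pi) ^ (-(3 / 2) : ℝ) * expRemainder M √3 * A) := by gcongr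
    _ = _ := by ring

end PhiTraceNorm

/-! ### Summation of the trace norm bounds -/

section Summation

variable {α σ Λ : ℝ}

/-- The bound `1 + (e^{√3} - 1) / √3` for the sum of the normalised moments. -/
noncomputable def momentSum : ℝ := 1 - 1 / √3 + Real.exp √3 / √3

theorem sum_momentCoeff_le (M : ℕ) :
    ∑ n ∈ Finset.range M, momentCoeff n / n.factorial ≤ momentSum := by
  have h3 : (1 : ℝ) ≤ √3 := Real.one_le_sqrt.2 (by norm_num)
  have hterm : ∀ n : ℕ, momentCoeff n / n.factorial
      -- For `n ≥ 1` the coefficient is `√3ⁿ / √3`; the extra summand corrects the term `n = 0`,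
      -- where it is `1`.
      ≤ (if n = 0 then 1 - 1 / √3 else 0) + √3 ^ n / n.factorial / √3 := fun n => by
    cases n with
    | zero => simp [momentCoeff]
    | succ n =>
      simp only [momentCoeff, Nat.succ_ne_zero, if_false, zero_add, pow_succ]
      apply le_of_eq
      field_simp
  calc ∑ n ∈ Finset.range M, momentCoeff n / n.factorial
      ≤ ∑ n ∈ Finset.range M, ((if n = 0 then 1 - 1 / √3 else 0) + √3 ^ n / n.factorial / √3) :=
        Finset.sum_le_sum fun n _ => hterm n
    _ = (∑ n ∈ Finset.range M, if n = 0 then 1 - 1 / √3 else 0)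
          + (∑ n ∈ Finset.range M, √3 ^ n / n.factorial) / √3 := by
        rw [Finset.sum_add_distrib, Finset.sum_div]
    _ ≤ (1 - 1 / √3) + Real.exp √3 / √3 := by
        have h1 : 1 / √3 ≤ 1 := (div_le_one (by positivity)).2 h3
        refine add_le_add ?_ ?_
        · rw [Finset.sum_ite_eq']
          split_ifs <;> linarith
        · gcongr
          exact Real.sum_le_exp_of_nonneg (Real.sqrt_nonneg 3) M

theorem exp_sqrt_three_le : Real.exp √3 ≤ 5.84 := by
  have h1 : √3 ≤ 7 / 4 := Real.sqrt_le_iff.2 (by norm_num)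
  refine (Real.exp_le_exp.2 h1).trans ?_
  have h2 : Real.exp (7 / 4) ^ 4 ≤ 5.84 ^ 4 := by
    rw [← Real.exp_nat_mul]
    have e : ((4 : ℕ) : ℝ) * (7 / 4) = ((7 : ℕ) : ℝ) * 1 := by norm_num
    rw [e, Real.exp_nat_mul]
    calc Real.exp 1 ^ 7 ≤ 2.7182818286 ^ 7 := by
          gcongr
          exact Real.exp_one_lt_d9.le
      _ ≤ _ := by norm_num
  exact (pow_le_pow_iff_left₀ (Real.exp_pos _).le (by norm_num) (by norm_num)).1 h2

theorem momentSum_nonneg : 0 ≤ momentSum := by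
  simpa using sum_momentCoeff_le 0

theorem momentSum_le : momentSum ≤ 3.8 := by
  have h3 : (1.73 : ℝ) ≤ √3 := Real.le_sqrt_of_sq_le (by norm_num)
  have h0 : 0 < √3 := by positivity
  have e : momentSum = 1 + (Real.exp √3 - 1) / √3 := by unfold momentSum; ring
  have h1 : (Real.exp √3 - 1) / √3 ≤ 2.8 := by
    rw [div_le_iff₀ h0]
    have := exp_sqrt_three_le
    linarith
  linarith

theorem toReal_eLpNorm_mul_norm_pow_le (hΛ : 0 < Λ) {φ : E3 → ℝ} (hφ : MemLp φ 2 volume)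
    (z : Fin 3 → ℤ) (n : ℕ) :
    (eLpNorm (fun x => φ x * ‖x - cellCenter Λ z‖ ^ n) 2 (volume.restrict (cell Λ z))).toReal
      ≤ |cellAverage Λ φ z| * (momentCoeff n * (1 / Λ) ^ n * √((2 / Λ) ^ 3))
        + (√3 / Λ) ^ n * (cellOscillation Λ φ z).toReal := by
  have hm := momentCoeff_nonneg n
  have h0 := cellOscillation_ne_top hΛ hφ z
  have h := ENNReal.toReal_mono (ENNReal.add_ne_top.2 ⟨ENNReal.ofReal_ne_top,
    ENNReal.mul_ne_top ENNReal.ofReal_ne_top h0⟩) (eLpNorm_mul_norm_pow_le hΛ hφ z n)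
  rwa [ENNReal.toReal_add ENNReal.ofReal_ne_top (ENNReal.mul_ne_top ENNReal.ofReal_ne_top h0),
    ENNReal.toReal_mul, ENNReal.toReal_ofReal (by positivity),
    ENNReal.toReal_ofReal (by positivity)] at h

/-- The bound for the trace norm of the part of `Φ` belonging to a cube. -/
theorem traceNormLE_sum_cellOperator (hΛ : 0 < Λ) {φ : E3 → ℝ} (hφ : MemLp φ 2 volume)
    (z : Fin 3 → ℤ) (M : ℕ) :
    TraceNormLE (∑ n ∈ Finset.range M, cellOperator hφ hΛ α σ z n)
      (3 * (2 * Real.pi) ^ (-(3 / 2) : ℝ) * √(4 / 3 * Real.pi * Λ ^ 3) * √α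
        * (|cellAverage Λ φ z| * √((2 / Λ) ^ 3) * momentSum
          + Real.exp √3 * (cellOscillation Λ φ z).toReal)) := by
  refine (TraceNormLE.sum _ fun n _ => traceNormLE_cellOperator (α := α) (σ := σ) hφ hΛ z n).mono ?_
  set c : ℝ := (2 * Real.pi) ^ (-(3 / 2) : ℝ) with hc
  have hc0 : 0 ≤ c := by positivity
  set B : ℝ := √(4 / 3 * Real.pi * Λ ^ 3) with hB
  set s : ℝ := √((2 / Λ) ^ 3) with hs
  set A : ℝ := |cellAverage Λ φ z| with hA
  set r : ℝ := (cellOscillation Λ φ z).toReal with hr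
  have hA0 : 0 ≤ A := abs_nonneg _
  have hr0 : 0 ≤ r := ENNReal.toReal_nonneg
  have hterm : ∀ n ∈ Finset.range M, 3 * (c / n.factorial * Λ ^ n * B * (√α *
      (eLpNorm (fun x => φ x * ‖x - cellCenter Λ z‖ ^ n) 2 (volume.restrict (cell Λ z))).toReal))
      ≤ 3 * c * B * √α * (A * s * (momentCoeff n / n.factorial) + √3 ^ n / n.factorial * r) :=
    fun n _ => by
      have h := toReal_eLpNorm_mul_norm_pow_le hΛ hφ z n
      calc _ ≤ 3 * (c / n.factorial * Λ ^ n * B * (√α *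
            (A * (momentCoeff n * (1 / Λ) ^ n * s) + (√3 / Λ) ^ n * r))) := by gcongr
        _ = _ := by
          rw [div_pow, div_pow, one_pow]
          field_simp
  refine (Finset.sum_le_sum hterm).trans ?_
  rw [← Finset.mul_sum, Finset.sum_add_distrib, ← Finset.mul_sum, ← Finset.sum_mul]
  gcongr
  · exact sum_momentCoeff_le M
  · exact Real.sum_le_exp_of_nonneg (Real.sqrt_nonneg 3) M

/-- The bound for the partial sums does not depend on the order of expansion, so it survives the
strong limit. Summed over the cubes, means give `‖φ‖₁` and deviations give `√|J| ‖g‖`. -/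
theorem traceNormLE_Phi (hΛ : 0 < Λ) {φ : Lp ℝ 2 (volume : Measure E3)}
    {g : Lp E3 2 (volume : Measure E3)} (hg : IsWeakGradient φ g) (hφ : Integrable φ volume)
    {J : Finset (Fin 3 → ℤ)} (hJ : ∀ᵐ x, ∀ z ∉ J, x ∈ cell Λ z → φ x = 0) :
    TraceNormLE (Phi α σ Λ φ)
      (3 * (2 * Real.pi) ^ (-(3 / 2) : ℝ) * √(4 / 3 * Real.pi * Λ ^ 3) * √α
        * (√((Λ / 2) ^ 3) * momentSum * (∫ x, |φ x|)
          + Real.exp √3 * (√J.card * √(48 * √3 * Real.pi) * (‖g‖ / Λ)))) := by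
  refine TraceNormLE.of_tendsto (fun M => ?_) (tendsto_cellPartialSum hΛ φ hJ)
  refine (TraceNormLE.sum J fun z _ =>
    traceNormLE_sum_cellOperator (α := α) (σ := σ) hΛ (Lp.memLp φ) z M).mono ?_
  rw [← Finset.mul_sum, Finset.sum_add_distrib, ← Finset.mul_sum, ← Finset.sum_mul,
    ← Finset.sum_mul]
  have hm := momentSum_nonneg
  have hs : ((2 / Λ) ^ 3)⁻¹ * √((2 / Λ) ^ 3) = √((Λ / 2) ^ 3) := by
    have e : (Λ / 2) ^ 3 = ((2 / Λ) ^ 3)⁻¹ := by rw [← inv_pow, inv_div]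
    rw [e, Real.sqrt_inv]
    have h1 : √((2 / Λ) ^ 3) * √((2 / Λ) ^ 3) = (2 / Λ) ^ 3 := Real.mul_self_sqrt (by positivity)
    have h2 : √((2 / Λ) ^ 3) ≠ 0 := by positivity
    rw [← h1]
    rw [Real.sqrt_mul_self (by positivity)]
    field_simp
  have havg : ∑ z ∈ J, |cellAverage Λ φ z| ≤ ((2 / Λ) ^ 3)⁻¹ * ∫ x, |φ x| := by
    calc ∑ z ∈ J, |cellAverage Λ φ z|
        ≤ ∑ z ∈ J, ((2 / Λ) ^ 3)⁻¹ * ∫ x in cell Λ z, |φ x| :=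
          Finset.sum_le_sum fun z _ => abs_cellAverage_le hΛ φ z
      _ ≤ _ := by
          rw [← Finset.mul_sum]
          gcongr
          exact sum_setIntegral_cell_abs_le hφ J
  refine mul_le_mul_of_nonneg_left (add_le_add ?_ (mul_le_mul_of_nonneg_left
    (sum_toReal_cellOscillation_le hΛ hg J) (Real.exp_pos _).le)) (by positivity)
  calc (∑ z ∈ J, |cellAverage Λ φ z|) * √((2 / Λ) ^ 3) * momentSum
        ≤ (((2 / Λ) ^ 3)⁻¹ * (∫ x, |φ x|)) * √((2 / Λ) ^ 3) * momentSum := by gcongr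
      _ = (((2 / Λ) ^ 3)⁻¹ * √((2 / Λ) ^ 3)) * momentSum * ∫ x, |φ x| := by ring
      _ = _ := by rw [hs]

theorem opTrace_sqrtDiff_two_smul_le {H W : Type*} [NormedAddCommGroup H] [InnerProductSpace ℂ H]
    [CompleteSpace H] [NormedAddCommGroup W] [InnerProductSpace ℂ W] [CompleteSpace W]
    {K : H →L[ℂ] H} {T : H →L[ℂ] W} {S : ℝ} (hK : 0 ≤ K) (h : TraceNormLE T S) :
    opTrace (sqrtDiff K ((2 : ℂ) • (ContinuousLinearMap.adjoint T ∘L T)))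
      ≤ ENNReal.ofReal (√2 * S) := by
  have h2 : ((√2 : ℝ) : ℂ) * ((√2 : ℝ) : ℂ) = 2 := by
    rw [← Complex.ofReal_mul, Real.mul_self_sqrt (by norm_num)]
    norm_num
  have e : (2 : ℂ) • (ContinuousLinearMap.adjoint T ∘L T)
      = ContinuousLinearMap.adjoint (((√2 : ℝ) : ℂ) • T) ∘L (((√2 : ℝ) : ℂ) • T) := by
    rw [map_smulₛₗ, Complex.conj_ofReal]
    ext f
    simp only [smul_apply, ContinuousLinearMap.comp_apply, map_smul, smul_smul, h2]
  have hT := h.smul ((√2 : ℝ) : ℂ)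
  rw [Complex.norm_real, Real.norm_of_nonneg (Real.sqrt_nonneg 2)] at hT
  rw [e]
  exact opTrace_sqrtDiff_le hK hT

theorem X_two_smul_Theta_le {φ : Lp ℝ 2 (volume : Measure E3)} {S : ℝ}
    (h : TraceNormLE (Phi α σ Λ φ) S) :
    (1 / 2 : ℝ≥0∞) * X σ Λ ((2 : ℂ) • Theta α σ Λ φ) ≤ ENNReal.ofReal (√2 / 2 * S) := by
  have hX : X σ Λ ((2 : ℂ) • Theta α σ Λ φ) ≤ ENNReal.ofReal (√2 * S) :=
    opTrace_sqrtDiff_two_smul_le (absK_nonneg σ Λ) h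
  have h12 : (1 / 2 : ℝ≥0∞) = ENNReal.ofReal (1 / 2) := by
    rw [ENNReal.ofReal_div_of_pos (by norm_num)]
    simp
  calc (1 / 2 : ℝ≥0∞) * X σ Λ ((2 : ℂ) • Theta α σ Λ φ)
      ≤ (1 / 2 : ℝ≥0∞) * ENNReal.ofReal (√2 * S) := by gcongr
    _ = _ := by
        rw [h12, ← ENNReal.ofReal_mul (by norm_num)]
        congr 1
        ring

end Summation

/-! ### The covering of a ball by cubes -/

section Covering

/-- Indices of cubes covering the ball of radius `L`. -/
noncomputable def coveringIndices (L Λ : ℝ) : Finset (Fin 3 → ℤ) :=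
  Fintype.piFinset fun _ => Finset.Ico (-(⌈L * Λ / 2⌉₊ : ℤ)) ⌈L * Λ / 2⌉₊

theorem card_coveringIndices_le {L Λ : ℝ} (hL : 0 < L) (hΛ : 0 < Λ) :
    ((coveringIndices L Λ).card : ℝ) ≤ 8 * (L * Λ + 1) ^ 3 := by
  have h : (coveringIndices L Λ).card = (2 * ⌈L * Λ / 2⌉₊) ^ 3 := by
    rw [coveringIndices, Fintype.card_piFinset]
    simp only [Int.card_Ico, Finset.prod_const, Finset.card_univ, Fintype.card_fin]
    congr 1
    omega
  rw [h]
  push_cast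
  have h1 : (⌈L * Λ / 2⌉₊ : ℝ) ≤ L * Λ / 2 + 1 := (Nat.ceil_lt_add_one (by positivity)).le
  calc (2 * (⌈L * Λ / 2⌉₊ : ℝ)) ^ 3 ≤ (2 * (L * Λ + 1)) ^ 3 := by
        gcongr
        nlinarith [mul_pos hL hΛ]
    _ = _ := by ring

theorem notMem_ball_of_notMem_coveringIndices {L Λ : ℝ} (hΛ : 0 < Λ)
    {z : Fin 3 → ℤ} (hz : z ∉ coveringIndices L Λ) {x : E3} (hx : x ∈ cell Λ z) :
    x ∉ Metric.ball (0 : E3) L := by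
  intro hxL
  refine hz ?_
  rw [coveringIndices, Fintype.mem_piFinset]
  intro i
  rw [← hx i, Finset.mem_Ico]
  have h1 : |x i| < L := lt_of_le_of_lt (PiLp.norm_apply_le x i) (mem_ball_zero_iff.1 hxL)
  have h2 : |x i * (Λ / 2)| < L * Λ / 2 := by
    rw [abs_mul, abs_of_pos (by positivity : 0 < Λ / 2), mul_div_assoc]
    gcongr
  rw [abs_lt] at h2
  have h3 : L * Λ / 2 ≤ (⌈L * Λ / 2⌉₊ : ℝ) := Nat.le_ceil _
  constructor
  · rw [Int.le_floor]
    push_cast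
    linarith [h2.1]
  · rw [Int.floor_lt]
    push_cast
    linarith [h2.2]

end Covering

/-! ### Comparison of constants -/

section Constants

theorem rpow_three_half {x : ℝ} (hx : 0 ≤ x) : x ^ (3 / 2 : ℝ) = √(x ^ 3) := by
  rw [Real.sqrt_eq_rpow, ← Real.rpow_natCast, ← Real.rpow_mul hx]
  norm_num

theorem two_pi_rpow_sq : ((2 * Real.pi) ^ (-(3 / 2) : ℝ)) ^ 2 = 1 / (2 * Real.pi) ^ 3 := by
  rw [Real.rpow_neg (by positivity), rpow_three_half (by positivity), inv_pow,
    Real.sq_sqrt (by positivity), one_div]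

theorem two_pi_rpow_le_one : (2 * Real.pi) ^ (-(3 / 2) : ℝ) ≤ 1 :=
  Real.rpow_le_one_of_one_le_of_nonpos (by linarith [Real.pi_gt_three]) (by norm_num)

theorem main_coefficient_le {α Λ : ℝ} (hα : 0 < α) (hΛ : 0 < Λ) :
    √2 / 2 * (3 * (2 * Real.pi) ^ (-(3 / 2) : ℝ) * √(4 / 3 * Real.pi * Λ ^ 3) * √α
      * (√((Λ / 2) ^ 3) * momentSum)) ≤ √(4 * α / (9 * Real.pi)) * Λ ^ 3 := by
  have hm := momentSum_nonneg
  have hπ := Real.pi_pos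
  refine (pow_le_pow_iff_left₀ (by positivity) (by positivity) two_ne_zero).1 ?_
  simp only [mul_pow, div_pow √2]
  rw [two_pi_rpow_sq, Real.sq_sqrt (by positivity), Real.sq_sqrt (by positivity),
    Real.sq_sqrt (by positivity), Real.sq_sqrt (by positivity), Real.sq_sqrt (by positivity)]
  -- After squaring, this is exactly what the claimed constant requires, as `128/27 = (32/3)·(4/9)`;
  -- numerically `14.44 < 14.88`.
  have hG : momentSum ^ 2 ≤ 128 / 27 * Real.pi := by
    calc momentSum ^ 2 ≤ 3.8 ^ 2 := by gcongr; exact momentSum_le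
      _ ≤ 128 / 27 * 3.14 := by norm_num
      _ ≤ _ := by gcongr; exact Real.pi_gt_d2.le
  calc _ = 3 / 32 * (α * (Λ ^ 3) ^ 2 / Real.pi ^ 2) * momentSum ^ 2 := by
        field_simp
        ring
    _ ≤ 3 / 32 * (α * (Λ ^ 3) ^ 2 / Real.pi ^ 2) * (128 / 27 * Real.pi) := by gcongr
    _ = _ := by
        field_simp
        ring

theorem cube_le_coefficient {σ Λ ε : ℝ} (hσ : 0 ≤ σ) (hσΛ : σ ≤ Λ) (hε : 0 < ε) :
    Λ ^ 3 ≤ (Λ ^ 3 - σ ^ 3) + 54 * ε * Λ ^ 3 + 5 * σ ^ (3 / 2 : ℝ) * Λ ^ (3 / 2 : ℝ) := by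
  have hΛ : 0 ≤ Λ := hσ.trans hσΛ
  have h1 : σ ^ 3 ≤ σ ^ (3 / 2 : ℝ) * Λ ^ (3 / 2 : ℝ) := by
    rw [rpow_three_half hσ, rpow_three_half hΛ]
    calc σ ^ 3 = √(σ ^ 3) * √(σ ^ 3) := (Real.mul_self_sqrt (by positivity)).symm
      _ ≤ _ := by gcongr
  have h2 : 0 ≤ 54 * ε * Λ ^ 3 := by positivity
  have h3 : 0 ≤ σ ^ (3 / 2 : ℝ) * Λ ^ (3 / 2 : ℝ) := by positivity
  linarith

/-- The constant in front of the gradient term. -/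
noncomputable def gradientConstant : ℝ :=
  3 * √(4 / 3 * Real.pi) * Real.exp √3 * √8 * √(48 * √3 * Real.pi)

theorem gradientConstant_pos : 0 < gradientConstant := by
  unfold gradientConstant
  positivity

theorem gradient_coefficient_le {α L Λ ε n : ℝ} (hL : 0 < L) (hΛ : 0 < Λ) (hε : 0 < ε)
    (hε1 : ε ≤ 1) (hn : n ≤ 8 * (L * Λ + 1) ^ 3) :
    √2 / 2 * (3 * (2 * Real.pi) ^ (-(3 / 2) : ℝ) * √(4 / 3 * Real.pi * Λ ^ 3) * √α
      * (Real.exp √3 * (√n * √(48 * √3 * Real.pi) * (1 / Λ))))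
      ≤ gradientConstant * α ^ (1 / 2 : ℝ) * (L * Λ + 1) ^ 3 / (ε ^ 2 * L ^ (3 / 2 : ℝ) * Λ) := by
  have hπ := Real.pi_pos
  have h2 : √2 / 2 ≤ 1 := by
    have : √2 ≤ 2 := Real.sqrt_le_iff.2 (by norm_num)
    linarith
  have hc0 : 0 ≤ (2 * Real.pi) ^ (-(3 / 2) : ℝ) := by positivity
  have hε2 : ε ^ 2 ≤ 1 := pow_le_one₀ hε.le hε1
  rw [← Real.sqrt_eq_rpow, rpow_three_half hL.le]
  -- The number of cubes supplies one factor `(LΛ+1)^{3/2}`; the other comes from `(LΛ)^{3/2} ≤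
  -- (LΛ+1)^{3/2}`, at the price of `L^{-3/2}`.
  have key : √(Λ ^ 3) * √n ≤ √8 * (L * Λ + 1) ^ 3 / √(L ^ 3) := by
    rw [le_div_iff₀ (by positivity)]
    calc √(Λ ^ 3) * √n * √(L ^ 3) ≤ √(Λ ^ 3) * √(8 * (L * Λ + 1) ^ 3) * √(L ^ 3) := by gcongr
      _ = √8 * (√((L * Λ) ^ 3) * √((L * Λ + 1) ^ 3)) := by
          rw [Real.sqrt_mul (by norm_num), mul_pow, Real.sqrt_mul (by positivity)]
          ring
      _ ≤ √8 * (√((L * Λ + 1) ^ 3) * √((L * Λ + 1) ^ 3)) := by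
          gcongr
          linarith
      _ = _ := by rw [Real.mul_self_sqrt (by positivity)]
  rw [Real.sqrt_mul (by positivity) (Λ ^ 3)]
  calc _ ≤ 1 * (3 * 1 * (√(4 / 3 * Real.pi) * √(Λ ^ 3)) * √α
        * (Real.exp √3 * (√n * √(48 * √3 * Real.pi) * (1 / Λ)))) := by
        gcongr
        exact two_pi_rpow_le_one
    _ = 3 * √(4 / 3 * Real.pi) * Real.exp √3 * √(48 * √3 * Real.pi) * √α * (1 / Λ)
          * (√(Λ ^ 3) * √n) := by ring
    _ ≤ 3 * √(4 / 3 * Real.pi) * Real.exp √3 * √(48 * √3 * Real.pi) * √α * (1 / Λ)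
          * (√8 * (L * Λ + 1) ^ 3 / √(L ^ 3)) := by gcongr
    _ = gradientConstant * √α * (L * Λ + 1) ^ 3 / (1 * √(L ^ 3) * Λ) := by
        unfold gradientConstant
        field_simp
    _ ≤ _ := by
        have := gradientConstant_pos
        gcongr

end Constants

theorem mainTheorem5 :
    ∃ C : ℝ, 0 < C ∧
      ∀ (α L σ Λ ε : ℝ), 0 < α → 0 < L → 0 ≤ σ → σ ≤ 1 → 1 ≤ Λ → 0 < ε → ε ≤ 1 →
      ∀ (φ : Lp ℝ 2 (volume : Measure E3)) (gradφ : Lp E3 2 (volume : Measure E3)),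
        MemY L φ gradφ → φ = |φ| →
        (1 / 2 : ℝ≥0∞) * X σ Λ ((2 : ℂ) • Theta α σ Λ φ) ≤
          ENNReal.ofReal
            (√(4 * α / (9 * Real.pi)) *
                ((Λ ^ 3 - σ ^ 3) + 54 * ε * Λ ^ 3
                  + 5 * σ ^ (3 / 2 : ℝ) * Λ ^ (3 / 2 : ℝ)) * (∫ x, |φ x|)
              + C * α ^ (1 / 2 : ℝ) * (L * Λ + 1) ^ 3 / (ε ^ 2 * L ^ (3 / 2 : ℝ) * Λ)
                * ‖gradφ‖) := by
  refine ⟨gradientConstant, gradientConstant_pos, ?_⟩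
  intro α L σ Λ ε hα hL hσ hσ1 hΛ1 hε hε1 φ gradφ hY _
  have hΛ : 0 < Λ := by linarith
  have hJ : ∀ᵐ x, ∀ z ∉ coveringIndices L Λ, x ∈ cell Λ z → φ x = 0 := by
    filter_upwards [hY.support] with x hx z hz hxz
    exact hx (notMem_ball_of_notMem_coveringIndices hΛ hz hxz)
  -- Square integrability and support in a ball make `‖φ‖₁` finite.
  have hint : Integrable φ volume := by
    have : IsFiniteMeasure (volume.restrict (Metric.ball (0 : E3) L)) :=
      isFiniteMeasure_restrict.2 measure_ball_lt_top.ne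
    have h1 : IntegrableOn φ (Metric.ball (0 : E3) L) volume :=
      ((Lp.memLp φ).mono_measure Measure.restrict_le_self).integrable one_le_two
    exact h1.integrable_of_ae_notMem_eq_zero hY.support
  refine (X_two_smul_Theta_le (traceNormLE_Phi hΛ hY.weakGradient hint hJ)).trans
    (ENNReal.ofReal_le_ofReal ?_)
  have hI : 0 ≤ ∫ x, |φ x| := integral_nonneg fun x => abs_nonneg _
  have b1 := mul_le_mul_of_nonneg_right (main_coefficient_le hα hΛ) hI
  have b2 := mul_le_mul_of_nonneg_right (gradient_coefficient_le (α := α) hL hΛ hε hε1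
    (card_coveringIndices_le hL hΛ)) (norm_nonneg gradφ)
  have b3 : √(4 * α / (9 * Real.pi)) * Λ ^ 3 * (∫ x, |φ x|) ≤ √(4 * α / (9 * Real.pi)) *
      ((Λ ^ 3 - σ ^ 3) + 54 * ε * Λ ^ 3 + 5 * σ ^ (3 / 2 : ℝ) * Λ ^ (3 / 2 : ℝ))
        * (∫ x, |φ x|) := by
    gcongr
    exact cube_le_coefficient hσ (hσ1.trans hΛ1) hε
  refine le_trans (le_of_eq ?_) (add_le_add (b1.trans b3) b2)
  ring
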